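/- Let $d,N$ be integers with $1\le d\le N$. Equip $\mathbb{C}^{d\times N}$ with the standard symplectic form $\omega_F(X,Y)=-\operatorname{Im}\operatorname{tr}(Y^*X)$, and let the unitary group $U(d)$ act on it by left multiplication. Identify the space $\mathcal{H}(d)$ of $d\times d$ Hermitian matrices with the dual $\mathfrak{u}(d)^*$ of the Lie algebra of skew-Hermitian matrices through the linear isomorphism $\alpha:\mathcal{H}(d)\to\mathfrak{u}(d)^*$, $\alpha_\xi(\eta)=\tfrac{i}{2}\operatorname{tr}(\eta^*\xi)$. A momentum map for a smooth action of $U(d)$ by diffeomorphisms preserving $\omega$ is a smooth map $\Phi$ into $\mathfrak{u}(d)^*$ such that, for every $\xi\in\mathfrak{u}(d)$, the function $\Phi^\xi(F)=\Phi(F)(\xi)$ and the vector field $X^\xi_F=\frac{d}{dt}\big|_{t=0}\exp(t\xi)\cdot F$ satisfy $\omega(X^\xi,\cdot)=d\Phi^\xi$, and such that $\Phi(A\cdot F)=\operatorname{Ad}^*_A\Phi(F)$ for all $A\in U(d)$, where $(\operatorname{Ad}^*_A\varphi)(\eta)=\varphi(A^*\eta A)$. A regular value of a smooth map is a point of its image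 over which the differential is surjective at every point of the fibre. A matrix $F\in\mathbb{C}^{d\times N}$ with columns $f_1,\dots,f_N$ is an $a$-tight frame ($a>0$) if $\sum_{i}|\langle v,f_i\rangle|^2=a\|v\|^2$ for all $v\in\mathbb{C}^d$; let $\mathcal{F}_{N/d}$ be the set of $N/d$-tight frames. Then the following hold. 1. $\omega$ is a symplectic form, $\alpha$ is an isomorphism, and the action of $U(d)$ on $(\mathbb{C}^{d\times N},\omega)$ is Hamiltonian with momentum map $\Phi:\mathbb{C}^{d\times N}\to\mathcal{H}(d)\cong\mathfrak{u}(d)^*$, $\Phi(F)=-FF^*$. 2. The regular values of $\Phi:\mathbb{C}^{d\times N}\to\mathcal{H}(d)$ are exactly the negative definite matrices in $\mathcal{H}(d)$. 3. $\mathcal{F}_{N/d}=\Phi^{-1}\bigl(-\tfrac{N}{d}\mathbb{I}_d\bigr)$, and $U(d)$ acts freely on this set. Hence $\mathcal{F}_{N/d}/U(d)$ is the symplectic quotient $\mathbb{C}^{d\times N}/\!\!/_{-\frac{N}{d}\mathbb{I}_d}U(d)$, and it carries a natural symplectic structure: $\mathcal{F}_{N/d}$, with inclusion $\iota$, is an embedded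 smooth submanifold of $\mathbb{C}^{d\times N}$ of dimension $2dN-d^2$; the quotient space $\mathcal{F}_{N/d}/U(d)$ is (with the quotient topology) a smooth manifold of dimension $2(dN-d^2)$ for which the projection $q:\mathcal{F}_{N/d}\to\mathcal{F}_{N/d}/U(d)$ is a smooth submersion; and there is a unique symplectic form $\omega_{\mathrm{red}}$ on $\mathcal{F}_{N/d}/U(d)$ with $q^*\omega_{\mathrm{red}}=\iota^*\omega$. -/

import Mathlib

open scoped Matrix Manifold ContDiff ComplexOrder Matrix.Norms.Elementwise

noncomputable section

namespace FrameReduction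

/-! ### Symplectic forms on manifolds -/

section Forms

variable {E : Type*} [NormedAddCommGroup E] [NormedSpace ℝ E]
  {M : Type*} [TopologicalSpace M] [ChartedSpace E M]
  {E' : Type*} [NormedAddCommGroup E'] [NormedSpace ℝ E']
  {M' : Type*} [TopologicalSpace M'] [ChartedSpace E' M']

/-- A (not necessarily smooth) field of alternating bilinear forms on the tangent spaces of a
manifold `M` modelled on `E`. -/
abbrev TwoForm (E : Type*) [NormedAddCommGroup E] [NormedSpace ℝ E]
    (M : Type*) [TopologicalSpace M] [ChartedSpace E M] : Type _ :=
  ∀ p : M, TangentSpace 𝓘(ℝ, E) p [⋀^Fin 2]→L[ℝ] ℝ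

/-- The pullback `f^* σ`, that is `(f^* σ)_p (X, Y) = σ_{f p} (df_p X, df_p Y)`. -/
def TwoForm.pullback (f : M' → M) (σ : TwoForm E M) : TwoForm E' M' :=
  fun p => (σ (f p)).compContinuousLinearMap (mfderiv 𝓘(ℝ, E') 𝓘(ℝ, E) f p)

/-- The expression of `σ` in the chart `e`: the pullback of `σ` along `e⁻¹`, regarded as a form on
(the open subset `e.target` of) the model vector space `E`. -/
def TwoForm.inChart (σ : TwoForm E M) (e : OpenPartialHomeomorph M E) :
    E → E [⋀^Fin 2]→L[ℝ] ℝ :=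
  (σ.pullback (e.symm : E → M) : TwoForm E E)

/-- A symplectic form: a smooth, closed, nondegenerate two-form. Smoothness and closedness are
checked in the charts of the atlas. -/
structure IsSymplecticForm (σ : TwoForm E M) : Prop where
  smooth : ∀ e ∈ atlas E M, ContDiffOn ℝ ∞ (σ.inChart e) e.target
  closed : ∀ e ∈ atlas E M, ∀ x ∈ e.target, extDeriv (σ.inChart e) x = 0
  nondegenerate : ∀ (p : M) (X : TangentSpace 𝓘(ℝ, E) p),
    (∀ Y : TangentSpace 𝓘(ℝ, E) p, σ p ![X, Y] = 0) → X = 0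

/-- Alternating bilinear forms on a vector space. -/
abbrev AltForm (E : Type*) [NormedAddCommGroup E] [NormedSpace ℝ E] : Type _ :=
  E [⋀^Fin 2]→L[ℝ] ℝ

/-- Two-forms on a vector space `E`, regarded as a manifold modelled on itself. -/
abbrev VectorSpaceTwoForm (E : Type*) [NormedAddCommGroup E] [NormedSpace ℝ E] : Type _ :=
  TwoForm E E

end Forms

/-! ### The unitary group, its Lie algebra, and the coadjoint action -/

/-- The unitary group `U(d)`. -/
abbrev U (d : ℕ) := Matrix.unitaryGroup (Fin d) ℂ

/-- The Lie algebra of `U(d)`: skew-Hermitian matrices. -/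
abbrev LieU (d : ℕ) : Submodule ℝ (Matrix (Fin d) (Fin d) ℂ) :=
  skewAdjoint.submodule ℝ (Matrix (Fin d) (Fin d) ℂ)

/-- Hermitian matrices, as a real vector space. -/
abbrev Herm (d : ℕ) : Submodule ℝ (Matrix (Fin d) (Fin d) ℂ) :=
  selfAdjoint.submodule ℝ (Matrix (Fin d) (Fin d) ℂ)

/-- The exponential map of `U(d)`. -/
def expU {d : ℕ} (ξ : LieU d) : U d :=
  ⟨NormedSpace.exp (ξ : Matrix (Fin d) (Fin d) ℂ), by
    have h : (ξ : Matrix (Fin d) (Fin d) ℂ)ᴴ = -ξ := ξ.2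
    rw [Matrix.mem_unitaryGroup_iff, Matrix.star_eq_conjTranspose, ← Matrix.exp_conjTranspose, h,
      ← Matrix.exp_add_of_commute _ _ (Commute.neg_right (Commute.refl (ξ : Matrix (Fin d) (Fin d) ℂ))), add_neg_cancel,
      NormedSpace.exp_zero]⟩

/-- The adjoint action `Ad_A η = A η A*` of `U(d)` on its Lie algebra. -/
def adU {d : ℕ} (A : U d) : LieU d →ₗ[ℝ] LieU d where
  toFun η := ⟨(A : Matrix (Fin d) (Fin d) ℂ) * η * (A : Matrix (Fin d) (Fin d) ℂ)ᴴ, by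
    have h : (η : Matrix (Fin d) (Fin d) ℂ)ᴴ = -η := η.2
    change _ᴴ = -_
    simp [Matrix.conjTranspose_mul, h, Matrix.mul_assoc]⟩
  map_add' x y := by ext1; simp [mul_add, add_mul]
  map_smul' c x := by ext1; simp

/-- The coadjoint action `(Ad*_A φ)(η) = φ (A* η A)` of `U(d)` on the dual of its Lie algebra. -/
def coadU {d : ℕ} (A : U d) (φ : Module.Dual ℝ (LieU d)) : Module.Dual ℝ (LieU d) :=
  φ ∘ₗ adU A⁻¹

/-- `(i/2) tr (η* ξ)` is real for `η` skew-Hermitian and `ξ` Hermitian. -/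
theorem alpha_im {d : ℕ} (ξ : Herm d) (η : LieU d) :
    (Complex.I / 2 * Matrix.trace ((η : Matrix (Fin d) (Fin d) ℂ)ᴴ * (ξ : Matrix (Fin d) (Fin d) ℂ))).im = 0 := by
  have hη : (η : Matrix (Fin d) (Fin d) ℂ)ᴴ = -η := η.2
  have hξ : (ξ : Matrix (Fin d) (Fin d) ℂ)ᴴ = ξ := ξ.2
  have h := Matrix.trace_conjTranspose ((η : Matrix (Fin d) (Fin d) ℂ)ᴴ * (ξ : Matrix (Fin d) (Fin d) ℂ))
  rw [Matrix.conjTranspose_mul, Matrix.conjTranspose_conjTranspose, hξ, Matrix.trace_mul_comm,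
    hη, Matrix.neg_mul, Matrix.trace_neg] at h
  have h2 := congrArg Complex.re h
  simp only [Complex.star_def, map_neg, Complex.neg_re, Complex.conj_re] at h2
  rw [hη, Matrix.neg_mul, Matrix.trace_neg, Complex.mul_im]
  simp
  linarith

/-- The map `α : H(d) → u(d)*`, `α_ξ(η) = (i/2) tr (η* ξ)`; this number is real by `alpha_im`. -/
def alpha (d : ℕ) : Herm d →ₗ[ℝ] Module.Dual ℝ (LieU d) :=
  LinearMap.mk₂ ℝ
    (fun ξ η => (Complex.I / 2 * Matrix.trace ((η : Matrix (Fin d) (Fin d) ℂ)ᴴ * (ξ : Matrix (Fin d) (Fin d) ℂ))).re)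
    (by intros; simp [mul_add])
    (by intros; simp; ring)
    (by intros; simp [add_mul, mul_add])
    (by intros; simp; ring)

/-! ### Hamiltonian actions of `U(d)`, regular values, orbit spaces -/

section Hamiltonian

variable {d : ℕ} {E : Type*} [NormedAddCommGroup E] [NormedSpace ℝ E] [MulAction (U d) E]

/-- The vector field `X^ξ` generated by `ξ`: `X^ξ_p = d/dt|_{t=0} exp (t ξ) • p`. -/
def fundamentalField (ξ : LieU d) (p : E) : E :=
  deriv (fun t : ℝ => expU (t • ξ) • p) 0

/-- `Φ : E → u(d)*` is a momentum map for the action of `U(d)` on `(E, σ)`, where `E` is a vector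
space regarded as a manifold. Smoothness of the action `U(d) × E → E` is expressed by a smooth
extension to the ambient space of the closed submanifold `U(d) × E`. -/
structure IsMomentumMap (σ : VectorSpaceTwoForm E) (Φ : E → Module.Dual ℝ (LieU d)) : Prop where
  smooth_action : ∃ Ψ : Matrix (Fin d) (Fin d) ℂ × E → E, ContDiff ℝ ∞ Ψ ∧
    ∀ (A : U d) (p : E), Ψ ((A : Matrix (Fin d) (Fin d) ℂ), p) = A • p
  preserves_form : ∀ A : U d, σ.pullback (fun p : E => A • p) = σ
  smooth : ∀ ξ : LieU d, ContDiff ℝ ∞ (fun p => Φ p ξ)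
  hamilton : ∀ (ξ : LieU d) (p Y : E),
    (σ p : AltForm E) ![fundamentalField (E := E) ξ p, Y] = fderiv ℝ (fun q : E => Φ q ξ) p Y
  equivariant : ∀ (A : U d) (p : E), Φ (A • p) = coadU A (Φ p)

end Hamiltonian

/-- `y` is a regular value of `f`: it is a value of `f`, and the differential of `f` is surjective
at every point of the fibre over `y`. -/
def IsRegularValue {E F : Type*} [NormedAddCommGroup E] [NormedSpace ℝ E]
    [NormedAddCommGroup F] [NormedSpace ℝ F] (f : E → F) (y : F) : Prop :=
  y ∈ Set.range f ∧ ∀ x, f x = y → Function.Surjective (fderiv ℝ f x)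

/-- The quotient of a subset `S` of a `G`-space, in the subspace topology, by the relation of lying
in the same `G`-orbit; it carries the quotient topology. -/
abbrev OrbitSpace (G : Type*) [Group G] {M : Type*} [MulAction G M] (S : Set M) : Type _ :=
  Quotient ((MulAction.orbitRel G M).comap (Subtype.val : S → M))

/-- The projection `q : S → S / G`. -/
def orbitProj (G : Type*) [Group G] {M : Type*} [MulAction G M] (S : Set M) :
    S → OrbitSpace G S :=
  Quotient.mk _

section Reduction

variable (G : Type*) [Group G] {E : Type*} [NormedAddCommGroup E] [NormedSpace ℝ E]
  [MulAction G E] (S : Set E)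
  (V : Type*) [NormedAddCommGroup V] [NormedSpace ℝ V]
  (W : Type*) [NormedAddCommGroup W] [NormedSpace ℝ W]

/-- The given atlases make `S` an embedded smooth submanifold of `E` (its topology is the subspace
topology) and `S / G` (with the quotient topology) a smooth manifold such that the projection
`S → S / G` is a smooth submersion. -/
structure IsSmoothReduction [ChartedSpace V S] [ChartedSpace W (OrbitSpace G S)] : Prop where
  manifold_level : IsManifold 𝓘(ℝ, V) ∞ S
  manifold_quotient : IsManifold 𝓘(ℝ, W) ∞ (OrbitSpace G S)
  t2_quotient : T2Space (OrbitSpace G S)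
  secondCountable_quotient : SecondCountableTopology (OrbitSpace G S)
  smooth_incl : ContMDiff 𝓘(ℝ, V) 𝓘(ℝ, E) ∞ (Subtype.val : S → E)
  immersion_incl : ∀ p : S,
    Function.Injective (mfderiv 𝓘(ℝ, V) 𝓘(ℝ, E) (Subtype.val : S → E) p)
  smooth_proj : ContMDiff 𝓘(ℝ, V) 𝓘(ℝ, W) ∞ (orbitProj G S)
  submersion_proj : ∀ p : S,
    Function.Surjective (mfderiv 𝓘(ℝ, V) 𝓘(ℝ, W) (orbitProj G S) p)

/-- The orbit space `S / G` of a subset `S` of `(E, σ)` is a reduced symplectic manifold: for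
suitable atlases, `S` is an `m`-dimensional embedded submanifold `ι : S → E` and `S / G` is an
`n`-dimensional manifold with submersion `q : S → S / G`, and there is a unique symplectic form
`σred` on `S / G` such that `q^* σred = ι^* σ`. -/
def HasReducedSymplecticForm (σ : VectorSpaceTwoForm E) (m n : ℕ) : Prop :=
  ∃ (_ : ChartedSpace (EuclideanSpace ℝ (Fin m)) S)
    (_ : ChartedSpace (EuclideanSpace ℝ (Fin n)) (OrbitSpace G S)),
    IsSmoothReduction G S (EuclideanSpace ℝ (Fin m)) (EuclideanSpace ℝ (Fin n)) ∧
    ∃! σred : TwoForm (EuclideanSpace ℝ (Fin n)) (OrbitSpace G S),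
      IsSymplecticForm σred ∧
      (σred.pullback (orbitProj G S) : TwoForm (EuclideanSpace ℝ (Fin m)) S) =
        TwoForm.pullback (Subtype.val : S → E) σ

end Reduction

/-! ### The space of matrices and tight frames -/

/-- The action of `U(d)` on `d × N` matrices by left multiplication. -/
instance leftMulAction (d N : ℕ) : MulAction (U d) (Matrix (Fin d) (Fin N) ℂ) where
  smul A F := (A : Matrix (Fin d) (Fin d) ℂ) * F
  one_smul F := by
    change ((1 : U d) : Matrix (Fin d) (Fin d) ℂ) * F = F
    rw [OneMemClass.coe_one, Matrix.one_mul]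
  mul_smul A B F := by
    change ((A * B : U d) : Matrix (Fin d) (Fin d) ℂ) * F =
      (A : Matrix (Fin d) (Fin d) ℂ) * ((B : Matrix (Fin d) (Fin d) ℂ) * F)
    rw [Submonoid.coe_mul, Matrix.mul_assoc]

/-- The alternating form `(X, Y) ↦ - Im tr (Y* X)` on `d × N` matrices. -/
def stdAlt (d N : ℕ) : AltForm (Matrix (Fin d) (Fin N) ℂ) where
  toFun v := -(Matrix.trace ((v 1)ᴴ * v 0)).im
  map_update_add' := by
    intro hdec m i x y
    rw [Subsingleton.elim hdec inferInstance]
    fin_cases i <;> simp [Matrix.mul_add, Matrix.add_mul] <;> ring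
  map_update_smul' := by
    intro hdec m i c x
    rw [Subsingleton.elim hdec inferInstance]
    fin_cases i <;> simp
  cont := by
    have h0 : Continuous fun v : Fin 2 → Matrix (Fin d) (Fin N) ℂ => v 0 := continuous_apply 0
    have h1 : Continuous fun v : Fin 2 → Matrix (Fin d) (Fin N) ℂ => v 1 := continuous_apply 1
    exact (Complex.continuous_im.comp (h1.matrix_conjTranspose.matrix_mul h0).matrix_trace).neg
  map_eq_zero_of_eq' := by
    intro v i j hv hij
    have h01 : v 0 = v 1 := by
      fin_cases i <;> fin_cases j <;> simp_all
    have h := congrArg Complex.im (Matrix.trace_conjTranspose ((v 1)ᴴ * v 0))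
    rw [Matrix.conjTranspose_mul, Matrix.conjTranspose_conjTranspose, h01] at h
    simp only [Complex.star_def, Complex.conj_im] at h
    rw [h01]
    linarith

/-- The standard symplectic form `σ_F(X, Y) = - Im tr (Y* X)` on `d × N` matrices. -/
def stdForm (d N : ℕ) : VectorSpaceTwoForm (Matrix (Fin d) (Fin N) ℂ) :=
  fun _ => stdAlt d N

/-- The map `F ↦ -F F*` with values in Hermitian matrices. -/
def momentum (d N : ℕ) (F : Matrix (Fin d) (Fin N) ℂ) : Herm d :=
  ⟨-(F * Fᴴ), by
    change _ᴴ = _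
    simp [Matrix.conjTranspose_mul]⟩

/-- The columns of `F` form a frame of `ℂ^d` with frame bounds `0 < a ≤ b`. -/
def IsFrameWithBounds {d N : ℕ} (a b : ℝ) (F : Matrix (Fin d) (Fin N) ℂ) : Prop :=
  0 < a ∧ a ≤ b ∧ ∀ v : EuclideanSpace ℂ (Fin d),
    a * ‖v‖ ^ 2 ≤ ∑ i, ‖inner ℂ v (WithLp.toLp 2 (fun k => F k i))‖ ^ 2 ∧
      ∑ i, ‖inner ℂ v (WithLp.toLp 2 (fun k => F k i))‖ ^ 2 ≤ b * ‖v‖ ^ 2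

/-- The space of `a`-tight frames of `N` vectors in `ℂ^d`. -/
def tightFrames (d N : ℕ) (a : ℝ) : Set (Matrix (Fin d) (Fin N) ℂ) :=
  {F | IsFrameWithBounds a a F}

end FrameReduction

end

open FrameReduction

/-!
Since `dΦ_F(T) = -(T F* + F T*)`, the value `Φ(F) = -F F*` is regular exactly when `F F*` is
invertible. On a level set `F F* = c • 1` the radical of `ω` restricted to `ker dΦ_F` consists of
the orbit directions `ξ F` with `ξ` skew-Hermitian, the momentum condition giving one inclusion
and the test vectors `i Z` the other.

Around a frame `F₀` the affine coordinate `F ↦ (F F₀*)⁻¹ F` of the Grassmannian is constant on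
orbits, and its differential vanishes on a vector tangent to the level set exactly when that vector
is an orbit direction. Its fibres therefore cut out local slices for the action, which give charts
both on the level set and on its quotient; the quotient is Hausdorff because the Gram matrix `F* F`
separates orbits.

The reduced form is the pullback of `ω` along a local lift into a slice. Two lifts of the same
tangent vector differ by a unitary and by a vector of the radical, so the choice of the lift does
not matter, and the form is closed because it is locally a pullback of a constant form.
-/

namespace FrameReduction

/-! ### Constant two-forms -/

section Pullback

open ContinuousAlternatingMap

variable {E F G : Type*} [NormedAddCommGroup E] [NormedSpace ℝ E]
  [NormedAddCommGroup F] [NormedSpace ℝ F] [NormedAddCommGroup G] [NormedSpace ℝ G]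

set_option maxSynthPendingDepth 3 in
theorem contDiff_compContinuousLinearMapCLM (k : ℕ) :
    ContDiff ℝ ∞ (compContinuousLinearMapCLM :
      (E →L[ℝ] F) → (F [⋀^Fin k]→L[ℝ] G) →L[ℝ] (E [⋀^Fin k]→L[ℝ] G)) := by
  induction k with
  | zero =>
    have hconst : (compContinuousLinearMapCLM :
        (E →L[ℝ] F) → (F [⋀^Fin 0]→L[ℝ] G) →L[ℝ] (E [⋀^Fin 0]→L[ℝ] G)) =
          fun _ => compContinuousLinearMapCLM 0 := by
      ext L θ v
      exact congrArg θ (Subsingleton.elim _ _)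
    exact hconst ▸ contDiff_const
  | succ k ih =>
    have hrec : (compContinuousLinearMapCLM :
        (E →L[ℝ] F) → (F [⋀^Fin (k + 1)]→L[ℝ] G) →L[ℝ] (E [⋀^Fin (k + 1)]→L[ℝ] G)) =
          fun L => ((k + 1 : ℝ)⁻¹ • alternatizeUncurryFinCLM ℝ E G) ∘L
            (ContinuousLinearMap.compL ℝ E _ _ (compContinuousLinearMapCLM L)) ∘L
            ((ContinuousLinearMap.compL ℝ E F (F [⋀^Fin k]→L[ℝ] G)).flip L) ∘L
            curryLeftLI.toContinuousLinearMap := by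
      ext1 L
      ext1 θ
      have h := alternatizeUncurryFin_curryLeft (θ.compContinuousLinearMap L)
      have hk : (k + 1 : ℝ) ≠ 0 := by positivity
      calc θ.compContinuousLinearMap L
          = (k + 1 : ℝ)⁻¹ • alternatizeUncurryFin (θ.compContinuousLinearMap L).curryLeft := by
            rw [h, ← Nat.cast_smul_eq_nsmul ℝ, Nat.cast_succ, inv_smul_smul₀ hk]
        _ = _ := by
            congr 2
            ext1 x
            exact curryLeft_compContinuousLinearMap θ L x
    have hpost : ContDiff ℝ ∞ fun L : E →L[ℝ] F => ContinuousLinearMap.compL ℝ E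
        (F [⋀^Fin k]→L[ℝ] G) (E [⋀^Fin k]→L[ℝ] G) (compContinuousLinearMapCLM L) :=
      (ContinuousLinearMap.contDiff _).comp ih
    have hpre : ContDiff ℝ ∞ fun L : E →L[ℝ] F =>
        (ContinuousLinearMap.compL ℝ E F (F [⋀^Fin k]→L[ℝ] G)).flip L :=
      ContinuousLinearMap.contDiff (E := E →L[ℝ] F)
        (F := (F →L[ℝ] F [⋀^Fin k]→L[ℝ] G) →L[ℝ] E →L[ℝ] F [⋀^Fin k]→L[ℝ] G) _
    rw [hrec]
    exact contDiff_const.clm_comp (hpost.clm_comp (hpre.clm_comp contDiff_const))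

theorem contDiff_compContinuousLinearMap {k : ℕ} (θ : F [⋀^Fin k]→L[ℝ] G) :
    ContDiff ℝ ∞ (fun L : E →L[ℝ] F => θ.compContinuousLinearMap L) :=
  (ContinuousLinearMap.apply ℝ (E [⋀^Fin k]→L[ℝ] G) θ).contDiff.comp
    (contDiff_compContinuousLinearMapCLM k)

theorem extDeriv_const {k : ℕ} (θ : F [⋀^Fin k]→L[ℝ] G) (x : F) :
    extDeriv (fun _ : F => θ) x = 0 := by
  ext v
  simp [extDeriv_apply (differentiableAt_const θ)]

theorem extDeriv_pullback_const {k : ℕ} (θ : F [⋀^Fin k]→L[ℝ] G) {f : E → F} {x : E}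
    (hf : ContDiffAt ℝ ∞ f x) :
    extDeriv (fun x => θ.compContinuousLinearMap (fderiv ℝ f x)) x = 0 := by
  have hsmooth : minSmoothness ℝ 2 ≤ ∞ := by
    simpa using WithTop.coe_le_coe.2 (le_top : (2 : ℕ∞) ≤ ⊤)
  rw [extDeriv_pullback (differentiableAt_const θ) hf hsmooth, extDeriv_const]
  ext
  simp

theorem compContinuousLinearMap_pair (θ : F [⋀^Fin 2]→L[ℝ] G) (L : E →L[ℝ] F) (X Y : E) :
    θ.compContinuousLinearMap L ![X, Y] = θ ![L X, L Y] :=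
  congrArg θ (by ext i; fin_cases i <;> rfl)

theorem altForm_ext {θ θ' : F [⋀^Fin 2]→L[ℝ] G} (h : ∀ X Y, θ ![X, Y] = θ' ![X, Y]) : θ = θ' := by
  ext v
  have hv : v = ![v 0, v 1] := by
    ext i
    fin_cases i <;> rfl
  rw [hv]
  exact h (v 0) (v 1)

theorem altForm_swap (θ : F [⋀^Fin 2]→L[ℝ] G) (X Y : F) : θ ![X, Y] = -θ ![Y, X] := by
  have hswap : ![X, Y] = ![Y, X] ∘ Equiv.swap 0 1 := by
    ext i
    fin_cases i <;> rfl
  rw [hswap]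
  exact θ.toAlternatingMap.map_swap _ (by decide)

end Pullback

section ConstantForms

variable {E : Type*} [NormedAddCommGroup E] [NormedSpace ℝ E]

theorem inChart_const (θ : AltForm E) {e : OpenPartialHomeomorph E E} (he : e ∈ atlas E E) :
    TwoForm.inChart (fun _ => θ : VectorSpaceTwoForm E) e = fun _ => θ := by
  obtain rfl : e = OpenPartialHomeomorph.refl E := by rwa [chartedSpaceSelf_atlas] at he
  funext x
  change θ.compContinuousLinearMap (mfderiv 𝓘(ℝ, E) 𝓘(ℝ, E) id x) = θ
  rw [mfderiv_id]
  rfl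

theorem isSymplecticForm_const {θ : AltForm E} (hθ : ∀ X, (∀ Y, θ ![X, Y] = 0) → X = 0) :
    IsSymplecticForm (fun _ => θ : VectorSpaceTwoForm E) where
  smooth e he := by
    rw [inChart_const θ he]
    exact contDiffOn_const
  closed e he x _ := by
    rw [inChart_const θ he]
    exact extDeriv_const θ x
  nondegenerate _ := hθ

end ConstantForms

theorem twoForm_eq_of_pullback_eq {V W : Type*} [NormedAddCommGroup V] [NormedSpace ℝ V]
    [NormedAddCommGroup W] [NormedSpace ℝ W]
    {M M' : Type*} [TopologicalSpace M] [ChartedSpace V M] [TopologicalSpace M']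
    [ChartedSpace W M'] {f : M → M'} (hf : Function.Surjective f)
    (hsub : ∀ p, Function.Surjective (mfderiv 𝓘(ℝ, V) 𝓘(ℝ, W) f p)) {σ τ : TwoForm W M'}
    (h : (σ.pullback f : TwoForm V M) = τ.pullback f) : σ = τ := by
  funext x
  obtain ⟨p, rfl⟩ := hf x
  ext v
  choose u hu using fun i => hsub p (v i)
  have hv : mfderiv 𝓘(ℝ, V) 𝓘(ℝ, W) f p ∘ u = v := funext hu
  have hpull := DFunLike.congr_fun (congrFun h p) u
  simpa only [TwoForm.pullback, ContinuousAlternatingMap.compContinuousLinearMap_apply, hv]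
    using hpull

/-! ### Local inverses and sections -/

section LocalSections

open Set Filter Topology

variable {E F : Type*} [NormedAddCommGroup E] [NormedSpace ℝ E]
  [NormedAddCommGroup F] [NormedSpace ℝ F]

theorem exists_contDiffOn_localInverse [CompleteSpace E] {f : E → F} {U : Set E} {p : E}
    (hU : IsOpen U) (hf : ContDiffOn ℝ ∞ f U) (hp : p ∈ U) {f' : E ≃L[ℝ] F}
    (hf' : HasFDerivAt f (f' : E →L[ℝ] F) p) :
    ∃ V : Set F, IsOpen V ∧ f p ∈ V ∧ ∃ s : F → E, ContDiffOn ℝ ∞ s V ∧ s (f p) = p ∧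
      MapsTo s V U ∧ RightInvOn s f V := by
  have hsmooth (x : E) (hx : x ∈ U) : ContDiffAt ℝ ∞ f x := hf.contDiffAt (hU.mem_nhds hx)
  let e := (hsmooth p hp).toOpenPartialHomeomorph f hf' (by simp)
  have hpe : p ∈ e.source := (hsmooth p hp).mem_toOpenPartialHomeomorph_source hf' (by simp)
  let good : Set E := U ∩ fderiv ℝ f ⁻¹' range ((↑) : (E ≃L[ℝ] F) → E →L[ℝ] F)
  have hgood : IsOpen good :=
    ((hf.continuousOn_fderiv_of_isOpen hU (by simp)).isOpen_inter_preimage hU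
      ContinuousLinearEquiv.isOpen)
  have hfp : f p ∈ e.target := e.map_source hpe
  have hinv : e.symm (f p) = p := e.left_inv hpe
  refine ⟨e.target ∩ e.symm ⁻¹' good, e.symm.isOpen_inter_preimage hgood,
    ⟨hfp, ?_⟩, e.symm, ?_, hinv, fun y hy => hy.2.1, fun y hy => e.right_inv hy.1⟩
  · rw [mem_preimage, hinv]
    exact ⟨hp, f', hf'.fderiv.symm⟩
  · rintro y ⟨hy, hyU, L, hL⟩
    have hderiv : HasFDerivAt e (L : E →L[ℝ] F) (e.symm y) :=
      hL ▸ ((hsmooth _ hyU).differentiableAt (by simp)).hasFDerivAt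
    exact (e.contDiffAt_symm hy hderiv (hsmooth _ hyU)).contDiffWithinAt

theorem exists_contDiffOn_localSection [CompleteSpace E] [FiniteDimensional ℝ F] {f : E → F}
    {U : Set E} {p : E} (hU : IsOpen U) (hf : ContDiffOn ℝ ∞ f U) (hp : p ∈ U)
    (hsurj : Function.Surjective (fderiv ℝ f p)) :
    ∃ V : Set F, IsOpen V ∧ f p ∈ V ∧ ∃ s : F → E, ContDiffOn ℝ ∞ s V ∧ s (f p) = p ∧
      MapsTo s V U ∧ RightInvOn s f V := by
  have : CompleteSpace F := FiniteDimensional.complete ℝ F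
  obtain ⟨R, hR⟩ := (fderiv ℝ f p).exists_rightInverse_of_surjective
    (LinearMap.range_eq_top.2 hsurj)
  let line : F → E := fun y => p + R y
  have hline : ContDiff ℝ ∞ line := contDiff_const.add R.contDiff
  have hline_zero : line 0 = p := by simp [line]
  have hderiv : HasFDerivAt (f ∘ line) ((ContinuousLinearEquiv.refl ℝ F : F ≃L[ℝ] F) : F →L[ℝ] F)
      0 := by
    have hfp : HasFDerivAt f (fderiv ℝ f p) (line 0) := hline_zero ▸
      ((hf.contDiffAt (hU.mem_nhds hp)).differentiableAt (by simp)).hasFDerivAt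
    simpa [hR] using! hfp.comp 0 (R.hasFDerivAt.const_add p)
  obtain ⟨V, hV, hpV, s, hs, hsp, hsU, hright⟩ := exists_contDiffOn_localInverse
    (hU.preimage hline.continuous) (hf.comp hline.contDiffOn fun _ => id)
    (by rwa [mem_preimage, hline_zero]) hderiv
  rw [Function.comp_apply, hline_zero] at hpV hsp
  exact ⟨V, hV, hpV, line ∘ s, hline.comp_contDiffOn hs, by simp [hsp, hline_zero], hsU, hright⟩

end LocalSections

/-! ### Slices and the atlases they induce -/

section Slices

open Set Filter Topology

variable {E W X : Type*} [NormedAddCommGroup E] [NormedSpace ℝ E]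
  [NormedAddCommGroup W] [NormedSpace ℝ W] {S : Set E} {q : S → X}

/-- A local slice for a projection `q : S → X` of a subset of a vector space: a smooth map `coord`,
defined on an open subset `dom` of the ambient space, whose fibres on `S ∩ dom` are fibres of `q`,
together with a smooth local section `lift` of it with values in `S`. Slices play the role of
charts, keeping every smooth map involved between open subsets of vector spaces. -/
structure LocalSlice (q : S → X) (W : Type*) [NormedAddCommGroup W] [NormedSpace ℝ W] where
  dom : Set E
  coord : E → W
  target : Set W
  lift : W → S
  isOpen_dom : IsOpen dom
  isOpen_target : IsOpen target
  contDiffOn_coord : ContDiffOn ℝ ∞ coord dom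
  contDiffOn_lift : ContDiffOn ℝ ∞ (fun w => (lift w : E)) target
  coord_mem_target : ∀ p : S, (p : E) ∈ dom → coord p ∈ target
  lift_mem_dom : ∀ w ∈ target, (lift w : E) ∈ dom
  coord_lift : ∀ w ∈ target, coord (lift w) = w
  mem_dom_of_proj_eq : ∀ p p' : S, q p = q p' → (p : E) ∈ dom → (p' : E) ∈ dom
  proj_eq_iff : ∀ p p' : S, (p : E) ∈ dom → (p' : E) ∈ dom → (q p = q p' ↔ coord p = coord p')

namespace LocalSlice

variable (σ : LocalSlice q W)

theorem contDiffAt_coord {p : E} (hp : p ∈ σ.dom) : ContDiffAt ℝ ∞ σ.coord p :=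
  σ.contDiffOn_coord.contDiffAt (σ.isOpen_dom.mem_nhds hp)

theorem contDiffAt_lift {w : W} (hw : w ∈ σ.target) :
    ContDiffAt ℝ ∞ (fun w => (σ.lift w : E)) w :=
  σ.contDiffOn_lift.contDiffAt (σ.isOpen_target.mem_nhds hw)

theorem proj_lift_coord {p : S} (hp : (p : E) ∈ σ.dom) : q (σ.lift (σ.coord p)) = q p :=
  have hw := σ.coord_mem_target p hp
  (σ.proj_eq_iff _ _ (σ.lift_mem_dom _ hw) hp).2 (σ.coord_lift _ hw)

theorem surjInv_mem_dom (hq : Function.Surjective q) {p : S} (hp : (p : E) ∈ σ.dom) :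
    (Function.surjInv hq (q p) : S).1 ∈ σ.dom :=
  σ.mem_dom_of_proj_eq p _ (Function.surjInv_eq hq _).symm hp

theorem coord_surjInv (hq : Function.Surjective q) {p : S} (hp : (p : E) ∈ σ.dom) :
    σ.coord (Function.surjInv hq (q p) : S) = σ.coord p :=
  (σ.proj_eq_iff _ p (σ.surjInv_mem_dom hq hp) hp).1 (Function.surjInv_eq hq _)

variable [TopologicalSpace X]

/-- The chart of `X` induced by a local slice: it sends `q p` to `coord p`, and its inverse is
`q ∘ lift`. -/
noncomputable def chart (hq : IsOpenQuotientMap q) : OpenPartialHomeomorph X W where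
  toFun x := σ.coord (Function.surjInv hq.surjective x : S)
  invFun w := q (σ.lift w)
  source := q '' (Subtype.val ⁻¹' σ.dom)
  target := σ.target
  map_source' := by
    rintro _ ⟨p, hp, rfl⟩
    exact σ.coord_mem_target _ (σ.surjInv_mem_dom hq.surjective hp)
  map_target' w hw := ⟨_, σ.lift_mem_dom w hw, rfl⟩
  left_inv' := by
    rintro _ ⟨p, hp, rfl⟩
    rw [σ.coord_surjInv hq.surjective hp, σ.proj_lift_coord hp]
  right_inv' w hw := by
    rw [σ.coord_surjInv hq.surjective (σ.lift_mem_dom w hw), σ.coord_lift w hw]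
  open_source := hq.isOpenMap _ (σ.isOpen_dom.preimage continuous_subtype_val)
  open_target := σ.isOpen_target
  continuousOn_toFun := by
    rintro _ ⟨p, hp, rfl⟩
    have hcoord : ContinuousAt (fun p' : S => σ.coord p') p :=
      (σ.contDiffAt_coord hp).continuousAt.comp continuous_subtype_val.continuousAt
    refine (hq.continuousAt_comp_iff.1 (hcoord.congr ?_)).continuousWithinAt
    filter_upwards [(σ.isOpen_dom.preimage continuous_subtype_val).mem_nhds hp] with p' hp'
    exact (σ.coord_surjInv hq.surjective hp').symm
  continuousOn_invFun :=
    hq.continuous.comp_continuousOn (continuousOn_iff_continuous_domRestrict.2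
      (continuous_induced_rng.2 σ.contDiffOn_lift.continuousOn.domRestrict))

variable (hq : IsOpenQuotientMap q)

theorem proj_mem_chart_source_iff {p : S} : q p ∈ (σ.chart hq).source ↔ (p : E) ∈ σ.dom :=
  ⟨fun ⟨p', hp', h⟩ => σ.mem_dom_of_proj_eq p' p h hp', fun hp => ⟨p, hp, rfl⟩⟩

theorem chart_proj {p : S} (hp : (p : E) ∈ σ.dom) : σ.chart hq (q p) = σ.coord p :=
  σ.coord_surjInv hq.surjective hp

end LocalSlice

/-- The atlas of `X` consists of the charts induced by the slices `slice x`, and the preferred chart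
at `x` is the one induced by `slice x`. -/
structure IsSliceAtlas [TopologicalSpace X] [ChartedSpace W X] (hq : IsOpenQuotientMap q)
    (slice : X → LocalSlice q W) : Prop where
  chartAt_eq : ∀ x, chartAt W x = (slice x).chart hq
  atlas_eq : atlas W X = range fun x => (slice x).chart hq

theorem exists_isSliceAtlas [TopologicalSpace X] (hq : IsOpenQuotientMap q)
    (slice : X → LocalSlice q W) (hslice : ∀ p : S, (p : E) ∈ (slice (q p)).dom) :
    ∃ _ : ChartedSpace W X, IsSliceAtlas hq slice := by
  let _ : ChartedSpace W X :=
    { atlas := range fun x => (slice x).chart hq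
      chartAt x := (slice x).chart hq
      mem_chart_source x := by
        obtain ⟨p, rfl⟩ := hq.surjective x
        exact ((slice (q p)).proj_mem_chart_source_iff hq).2 (hslice p)
      chart_mem_atlas x := mem_range_self x }
  exact ⟨_, fun _ => rfl, rfl⟩

theorem mfderiv_eq_mfderiv_chartAt_comp {V M : Type*} [NormedAddCommGroup V] [NormedSpace ℝ V]
    [TopologicalSpace M] [ChartedSpace V M] [TopologicalSpace X] [ChartedSpace W X]
    [IsManifold 𝓘(ℝ, W) ∞ X] {f : M → X} {z : M} (hf : MDifferentiableAt 𝓘(ℝ, V) 𝓘(ℝ, W) f z) :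
    mfderiv 𝓘(ℝ, V) 𝓘(ℝ, W) f z = mfderiv 𝓘(ℝ, V) 𝓘(ℝ, W) (chartAt W (f z) ∘ f) z := by
  have hchart : MDifferentiableAt 𝓘(ℝ, W) 𝓘(ℝ, W) (chartAt W (f z)) (f z) :=
    mdifferentiableAt_atlas (chart_mem_atlas W (f z)) (mem_chart_source W (f z))
  simp only [mfderiv, hf, hchart.comp z hf, writtenInExtChartAt, extChartAt,
    mfld_simps]
  rfl

namespace IsSliceAtlas

variable [TopologicalSpace X] [ChartedSpace W X] {hq : IsOpenQuotientMap q}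
  {slice : X → LocalSlice q W}

theorem mem_dom (h : IsSliceAtlas hq slice) (p : S) : (p : E) ∈ (slice (q p)).dom :=
  ((slice (q p)).proj_mem_chart_source_iff hq).1 (h.chartAt_eq (q p) ▸ mem_chart_source W (q p))

theorem chartAt_proj (h : IsSliceAtlas hq slice) (p : S) :
    chartAt W (q p) (q p) = (slice (q p)).coord p := by
  rw [h.chartAt_eq, (slice (q p)).chart_proj hq (h.mem_dom p)]

theorem coord_mem_target (h : IsSliceAtlas hq slice) (p : S) :
    (slice (q p)).coord p ∈ (slice (q p)).target :=
  (slice (q p)).coord_mem_target p (h.mem_dom p)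

theorem isManifold (h : IsSliceAtlas hq slice) : IsManifold 𝓘(ℝ, W) ∞ X := by
  refine isManifold_of_contDiffOn _ _ _ ?_
  rw [h.atlas_eq]
  rintro _ _ ⟨x, rfl⟩ ⟨y, rfl⟩
  simp only [mfld_simps]
  rintro w ⟨hw, hy⟩
  have hdom : ∀ w', q ((slice x).lift w') ∈ ((slice y).chart hq).source ↔
      ((slice x).lift w' : E) ∈ (slice y).dom := fun _ => (slice y).proj_mem_chart_source_iff hq
  refine ContDiffWithinAt.congr (f := fun w => (slice y).coord ((slice x).lift w)) ?_
    (fun w' hw' => (slice y).chart_proj hq ((hdom w').1 hw'.2))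
    ((slice y).chart_proj hq ((hdom w).1 hy))
  exact (((slice y).contDiffAt_coord ((hdom w).1 hy)).comp w
    ((slice x).contDiffAt_lift hw)).contDiffWithinAt

end IsSliceAtlas

end Slices

section SliceCurves

open Set Filter Topology

variable {E V W X M : Type*} [NormedAddCommGroup E] [NormedSpace ℝ E]
  [NormedAddCommGroup V] [NormedSpace ℝ V] [NormedAddCommGroup W] [NormedSpace ℝ W] {S : Set E}
  [TopologicalSpace M] [ChartedSpace V M]

namespace IsSliceAtlas

section Projection

variable {q : S → X} [TopologicalSpace X] [ChartedSpace W X] {hq : IsOpenQuotientMap q}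
  {slice : X → LocalSlice q W}

theorem chartAt_comp_proj_eventuallyEq (h : IsSliceAtlas hq slice) {γ : M → S} {z : M}
    (hγ : ContinuousAt (fun z => (γ z : E)) z) :
    chartAt W (q (γ z)) ∘ q ∘ γ =ᶠ[𝓝 z] (slice (q (γ z))).coord ∘ fun z => (γ z : E) := by
  filter_upwards [hγ ((slice (q (γ z))).isOpen_dom.mem_nhds (h.mem_dom (γ z)))] with z' hz'
  simp only [Function.comp_apply, h.chartAt_eq]
  exact (slice (q (γ z))).chart_proj hq hz'

theorem contMDiffAt_proj_comp (h : IsSliceAtlas hq slice) {γ : M → S} {z : M}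
    (hγ : ContMDiffAt 𝓘(ℝ, V) 𝓘(ℝ, E) ∞ (fun z => (γ z : E)) z) :
    ContMDiffAt 𝓘(ℝ, V) 𝓘(ℝ, W) ∞ (q ∘ γ) z := by
  have hγ' : ContinuousAt γ z := Topology.IsInducing.subtypeVal.continuousAt_iff.2 hγ.continuousAt
  refine contMDiffAt_iff_target.2 ⟨hq.continuous.continuousAt.comp hγ', ?_⟩
  simp only [mfld_simps]
  exact (((slice (q (γ z))).contDiffAt_coord (h.mem_dom (γ z))).contMDiffAt.comp z
    hγ).congr_of_eventuallyEq (h.chartAt_comp_proj_eventuallyEq hγ.continuousAt)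

theorem mfderiv_proj_comp (h : IsSliceAtlas hq slice) {γ : M → S} {z : M}
    (hγ : ContMDiffAt 𝓘(ℝ, V) 𝓘(ℝ, E) ∞ (fun z => (γ z : E)) z) (u : TangentSpace 𝓘(ℝ, V) z) :
    mfderiv 𝓘(ℝ, V) 𝓘(ℝ, W) (q ∘ γ) z u = fderiv ℝ (slice (q (γ z))).coord (γ z)
      (mfderiv 𝓘(ℝ, V) 𝓘(ℝ, E) (fun z => (γ z : E)) z u) := by
  have := h.isManifold
  rw [mfderiv_eq_mfderiv_chartAt_comp ((h.contMDiffAt_proj_comp hγ).mdifferentiableAt (by simp)),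
    Function.comp_apply,
    (h.chartAt_comp_proj_eventuallyEq hγ.continuousAt).mfderiv_eq, mfderiv_comp z
      (((slice (q (γ z))).contDiffAt_coord (h.mem_dom (γ z))).contMDiffAt.mdifferentiableAt
        (by simp)) (hγ.mdifferentiableAt (by simp)), mfderiv_eq_fderiv]
  rfl

end Projection

section Submanifold

variable [ChartedSpace V S] {chart : S → LocalSlice (id : S → S) V}

theorem contMDiff_val (h : IsSliceAtlas IsOpenQuotientMap.id chart) :
    ContMDiff 𝓘(ℝ, V) 𝓘(ℝ, E) ∞ (Subtype.val : S → E) := by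
  intro p
  have hlift : ContMDiffAt 𝓘(ℝ, V) 𝓘(ℝ, E) ∞ (fun w => ((chart p).lift w : E))
      ((chart p).coord p) :=
    ((chart p).contDiffAt_lift (h.coord_mem_target p)).contMDiffAt
  have := h.isManifold
  have hchart : ContMDiffAt 𝓘(ℝ, V) 𝓘(ℝ, V) ∞ (chartAt V p) p :=
    contMDiffOn_chart.contMDiffAt (chart_source_mem_nhds V p)
  refine (hlift.comp_of_eq hchart (h.chartAt_proj p)).congr_of_eventuallyEq ?_
  filter_upwards [chart_source_mem_nhds V p] with p' hp'
  have hleft := (chartAt V p).left_inv hp'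
  rw [h.chartAt_eq] at hleft
  simp only [Function.comp_apply, h.chartAt_eq]
  exact congrArg Subtype.val hleft.symm

theorem mfderiv_val_injective (h : IsSliceAtlas IsOpenQuotientMap.id chart) (p : S) :
    Function.Injective (mfderiv 𝓘(ℝ, V) 𝓘(ℝ, E) (Subtype.val : S → E) p) := by
  refine Function.LeftInverse.injective (g := fderiv ℝ (chart p).coord p) fun u => ?_
  have hcoord := h.mfderiv_proj_comp (γ := id) (h.contMDiff_val p) u
  rw [Function.comp_id, mfderiv_id] at hcoord
  exact hcoord.symm

end Submanifold

end IsSliceAtlas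

end SliceCurves

/-! ### Reduction -/

section OrbitSpaces

open Set

variable {G M : Type*} [Group G] [MulAction G M] {S : Set M}

theorem orbitProj_eq_iff {p p' : S} :
    orbitProj G S p = orbitProj G S p' ↔ ∃ g : G, g • (p' : M) = p := by
  rw [orbitProj, Quotient.eq]
  rfl

theorem isOpenQuotientMap_orbitProj [TopologicalSpace M] [ContinuousConstSMul G M]
    (hS : ∀ (g : G), ∀ p ∈ S, g • p ∈ S) : IsOpenQuotientMap (orbitProj G S) := by
  refine ⟨Quotient.mk_surjective, continuous_quotient_mk', fun O hO => ?_⟩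
  have hquot : Topology.IsQuotientMap (orbitProj G S) := isQuotientMap_quotient_mk'
  have hsat : orbitProj G S ⁻¹' (orbitProj G S '' O) =
      ⋃ g : G, (fun p : S => (⟨g • (p : M), hS g p p.2⟩ : S)) ⁻¹' O := by
    ext p
    simp only [mem_preimage, mem_image, mem_iUnion]
    constructor
    · rintro ⟨p', hp', hpp'⟩
      obtain ⟨g, hg⟩ := orbitProj_eq_iff.1 hpp'
      exact ⟨g, by convert hp'⟩
    · rintro ⟨g, hg⟩
      exact ⟨_, hg, orbitProj_eq_iff.2 ⟨g, rfl⟩⟩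
  rw [← hquot.isOpen_preimage, hsat]
  exact isOpen_iUnion fun g =>
    hO.preimage ((continuous_subtype_val.const_smul g).subtype_mk _)

end OrbitSpaces

section Reduction

open Set Filter Topology

variable {G : Type*} [Group G] {E F V W X M : Type*} [NormedAddCommGroup E] [NormedSpace ℝ E]
  [NormedAddCommGroup F] [NormedSpace ℝ F] [NormedAddCommGroup V] [NormedSpace ℝ V]
  [NormedAddCommGroup W] [NormedSpace ℝ W] [MulAction G E] {f : E → F} {y : F}
  {θ : AltForm E} [TopologicalSpace M] [ChartedSpace V M]

/-- The action of `G` on `E` is by diffeomorphisms preserving the constant two-form `θ` and the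
subset `S`. -/
structure PreservesForm (G : Type*) [Group G] [MulAction G E] (θ : AltForm E) (S : Set E) :
    Prop where
  contDiff_smul : ∀ g : G, ContDiff ℝ ∞ fun p : E => g • p
  pullback_smul : ∀ (g : G) (p : E), θ.compContinuousLinearMap (fderiv ℝ (g • ·) p) = θ
  smul_mem : ∀ (g : G), ∀ p ∈ S, g • p ∈ S

theorem PreservesForm.isOpenQuotientMap_orbitProj {S : Set E} (hG : PreservesForm G θ S) :
    IsOpenQuotientMap (orbitProj G S) :=
  have _ : ContinuousConstSMul G E := ⟨fun g => (hG.contDiff_smul g).continuous⟩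
  FrameReduction.isOpenQuotientMap_orbitProj hG.smul_mem

theorem LocalSlice.exists_lift_through {S : Set E} (σ : LocalSlice (orbitProj G S) W)
    (hG : PreservesForm G θ S) {p : S} (hp : (p : E) ∈ σ.dom) :
    ∃ γ : W → S, ContDiffAt ℝ ∞ (fun w => (γ w : E)) (σ.coord p) ∧ γ (σ.coord p) = p ∧
      (∀ w, orbitProj G S (γ w) = orbitProj G S (σ.lift w)) ∧
      θ.compContinuousLinearMap (fderiv ℝ (fun w => (γ w : E)) (σ.coord p)) =
        θ.compContinuousLinearMap (fderiv ℝ (fun w => (σ.lift w : E)) (σ.coord p)) := by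
  obtain ⟨g, hg⟩ := orbitProj_eq_iff.1 (σ.proj_lift_coord hp).symm
  have hlift := σ.contDiffAt_lift (σ.coord_mem_target p hp)
  refine ⟨fun w => ⟨g • (σ.lift w : E), hG.smul_mem g _ (σ.lift w).2⟩,
    (hG.contDiff_smul g).contDiffAt.comp _ hlift, Subtype.ext hg,
    fun w => orbitProj_eq_iff.2 ⟨g, rfl⟩, ?_⟩
  have hcomp := fderiv_comp (σ.coord p)
    ((hG.contDiff_smul g).differentiable (by simp) (σ.lift (σ.coord p)))
    (hlift.differentiableAt (by simp))
  refine (congrArg θ.compContinuousLinearMap hcomp).trans ?_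
  conv_rhs => rw [← hG.pullback_smul g (σ.lift (σ.coord p))]
  rfl

theorem LocalSlice.fderiv_coord_fderiv_lift_through {S : Set E} {q : S → X} (σ : LocalSlice q W)
    {p : S} (hp : (p : E) ∈ σ.dom) {γ : W → S}
    (hγ : ContDiffAt ℝ ∞ (fun w => (γ w : E)) (σ.coord p)) (hγp : γ (σ.coord p) = p)
    (hq : ∀ w, q (γ w) = q (σ.lift w)) (u : W) :
    fderiv ℝ σ.coord p (fderiv ℝ (fun w => (γ w : E)) (σ.coord p) u) = u := by
  have hcoord : σ.coord ∘ (fun w => (γ w : E)) =ᶠ[𝓝 (σ.coord p)] id := by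
    filter_upwards [σ.isOpen_target.mem_nhds (σ.coord_mem_target p hp)] with w hw
    have hlift := σ.lift_mem_dom w hw
    exact ((σ.proj_eq_iff _ _ (σ.mem_dom_of_proj_eq _ _ (hq w).symm hlift) hlift).1 (hq w)).trans
      (σ.coord_lift w hw)
  have hcomp := fderiv_comp (g := σ.coord) (σ.coord p)
    (by rw [hγp]; exact (σ.contDiffAt_coord hp).differentiableAt (by simp))
    (hγ.differentiableAt (by simp))
  rw [hcoord.fderiv_eq, fderiv_id, hγp] at hcomp
  exact (DFunLike.congr_fun hcomp u).symm

theorem fderiv_mfderiv_eq_zero {γ : M → f ⁻¹' {y}} {z : M}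
    (hf : DifferentiableAt ℝ f (γ z))
    (hγ : MDifferentiableAt 𝓘(ℝ, V) 𝓘(ℝ, E) (fun z => (γ z : E)) z)
    (u : TangentSpace 𝓘(ℝ, V) z) :
    fderiv ℝ f (γ z) (mfderiv 𝓘(ℝ, V) 𝓘(ℝ, E) (fun z => (γ z : E)) z u) = 0 := by
  have hcomp := mfderiv_comp z hf.mdifferentiableAt hγ
  have hconst : f ∘ (fun z => (γ z : E)) = fun _ => y := funext fun z => (γ z).2
  rw [hconst, mfderiv_const, mfderiv_eq_fderiv] at hcomp
  exact (DFunLike.congr_fun hcomp u).symm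

/-- On the tangent spaces `ker df` of the level set, the kernel of the differential of the slice
coordinate is the radical of the restriction of `θ`. -/
def LocalSlice.IsCharacteristic {q : f ⁻¹' {y} → X} (σ : LocalSlice q W) (θ : AltForm E) : Prop :=
  ∀ p : f ⁻¹' {y}, (p : E) ∈ σ.dom → ∀ v, fderiv ℝ f p v = 0 →
    (fderiv ℝ σ.coord p v = 0 ↔ ∀ w, fderiv ℝ f p w = 0 → θ ![v, w] = 0)

theorem LocalSlice.exists_tangent_lift {σ : LocalSlice (orbitProj G (f ⁻¹' {y})) W}
    (hG : PreservesForm G θ (f ⁻¹' {y})) {p : f ⁻¹' {y}} (hf : DifferentiableAt ℝ f p)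
    (hp : (p : E) ∈ σ.dom) :
    ∃ L : W →L[ℝ] E, (∀ u, fderiv ℝ f p (L u) = 0) ∧ (∀ u, fderiv ℝ σ.coord p (L u) = u) ∧
      θ.compContinuousLinearMap L =
        θ.compContinuousLinearMap (fderiv ℝ (fun w => (σ.lift w : E)) (σ.coord p)) := by
  obtain ⟨γ, hγ, hγp, hγq, hγθ⟩ := σ.exists_lift_through hG hp
  refine ⟨_, fun u => ?_, σ.fderiv_coord_fderiv_lift_through hp hγ hγp hγq, hγθ⟩
  have htangent := fderiv_mfderiv_eq_zero (γ := γ) (z := σ.coord p) (by rwa [hγp])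
    (hγ.differentiableAt (by simp)).mdifferentiableAt u
  rwa [hγp, mfderiv_eq_fderiv] at htangent

/-- The two-form on the orbit space of `S` obtained at each point by restricting `θ` to the slice
there. -/
noncomputable def reducedForm {S : Set E} [ChartedSpace W (OrbitSpace G S)] (θ : AltForm E)
    (slice : OrbitSpace G S → LocalSlice (orbitProj G S) W) : TwoForm W (OrbitSpace G S) :=
  fun x => θ.compContinuousLinearMap
    (fderiv ℝ (fun w => ((slice x).lift w : E)) (chartAt W x x))

namespace IsSliceAtlas

section Subset

variable {S : Set E} [ChartedSpace W (OrbitSpace G S)] {hq : IsOpenQuotientMap (orbitProj G S)}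
  {slice : OrbitSpace G S → LocalSlice (orbitProj G S) W}

theorem reducedForm_orbitProj (h : IsSliceAtlas hq slice) (p : S) :
    (reducedForm θ slice (orbitProj G _ p) : AltForm W) =
      θ.compContinuousLinearMap (fderiv ℝ (fun w => ((slice (orbitProj G _ p)).lift w : E))
        ((slice (orbitProj G _ p)).coord p)) :=
  congrArg (fun w => θ.compContinuousLinearMap (fderiv ℝ (fun w => ((slice _).lift w : E)) w))
    (h.chartAt_proj p)

variable [ChartedSpace V S] {chart : S → LocalSlice (id : S → S) V}

theorem mfderiv_orbitProj_surjective (h : IsSliceAtlas hq slice)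
    (hS : IsSliceAtlas IsOpenQuotientMap.id chart) (hG : PreservesForm G θ S)
    (p : S) :
    Function.Surjective (mfderiv 𝓘(ℝ, V) 𝓘(ℝ, W) (orbitProj G S) p) := by
  have hp := h.mem_dom p
  obtain ⟨γ, hγ, hγp, hγq, -⟩ := (slice (orbitProj G _ p)).exists_lift_through hG hp
  set w := (slice (orbitProj G _ p)).coord p
  suffices Function.Surjective (mfderiv 𝓘(ℝ, V) 𝓘(ℝ, W) (orbitProj G S) (γ w)) by
    rwa [hγp] at this
  refine fun u => ⟨mfderiv 𝓘(ℝ, W) 𝓘(ℝ, V) γ w u, ?_⟩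
  have hγS : MDifferentiableAt 𝓘(ℝ, W) 𝓘(ℝ, V) γ w :=
    (hS.contMDiffAt_proj_comp hγ.contMDiffAt).mdifferentiableAt (by simp)
  have hproj : MDifferentiableAt 𝓘(ℝ, V) 𝓘(ℝ, W) (orbitProj G S) (γ w) :=
    (h.contMDiffAt_proj_comp (γ := id) (hS.contMDiff_val _)).mdifferentiableAt (by simp)
  have hsection : fderiv ℝ (slice (orbitProj G S (γ w))).coord (γ w)
      (fderiv ℝ (fun w => (γ w : E)) w u) = u := by
    rw [hγp]
    exact (slice (orbitProj G _ p)).fderiv_coord_fderiv_lift_through hp hγ hγp hγq u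
  refine (DFunLike.congr_fun (mfderiv_comp w hproj hγS) u).symm.trans ?_
  refine (h.mfderiv_proj_comp hγ.contMDiffAt u).trans ?_
  rw [mfderiv_eq_fderiv]
  exact hsection

theorem isSmoothReduction (h : IsSliceAtlas hq slice)
    (hS : IsSliceAtlas IsOpenQuotientMap.id chart) (hG : PreservesForm G θ S)
    [SecondCountableTopology E] (hT2 : T2Space (OrbitSpace G S)) :
    IsSmoothReduction G S V W where
  manifold_level := hS.isManifold
  manifold_quotient := h.isManifold
  t2_quotient := hT2
  secondCountable_quotient := hq.isQuotientMap.secondCountableTopology hq.isOpenMap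
  smooth_incl := hS.contMDiff_val
  immersion_incl := hS.mfderiv_val_injective
  smooth_proj p := h.contMDiffAt_proj_comp (γ := id) (hS.contMDiff_val p)
  submersion_proj := h.mfderiv_orbitProj_surjective hS hG

end Subset

section LevelSet

variable [ChartedSpace W (OrbitSpace G (f ⁻¹' {y}))]
  {hq : IsOpenQuotientMap (orbitProj G (f ⁻¹' {y}))}
  {slice : OrbitSpace G (f ⁻¹' {y}) → LocalSlice (orbitProj G (f ⁻¹' {y})) W}

theorem reducedForm_fderiv_coord (h : IsSliceAtlas hq slice)
    (hG : PreservesForm G θ (f ⁻¹' {y})) (hslice : ∀ x, (slice x).IsCharacteristic θ)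
    {p : f ⁻¹' {y}} (hf : DifferentiableAt ℝ f p) {u v : E} (hu : fderiv ℝ f p u = 0)
    (hv : fderiv ℝ f p v = 0) :
    (reducedForm θ slice (orbitProj G _ p) : AltForm W)
      ![fderiv ℝ (slice (orbitProj G _ p)).coord p u,
        fderiv ℝ (slice (orbitProj G _ p)).coord p v] = θ ![u, v] := by
  rw [h.reducedForm_orbitProj]
  have hp : (p : E) ∈ (slice (orbitProj G _ p)).dom := h.mem_dom p
  generalize hσ : slice (orbitProj G _ p) = σ at hp
  have hchar : σ.IsCharacteristic θ := hσ ▸ hslice _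
  obtain ⟨L, hLf, hLc, hLθ⟩ := σ.exists_tangent_lift hG hf hp
  -- `u` and its lift `L (dcoord u)` differ by a vector of the radical
  have hleft (u w : E) (hu : fderiv ℝ f p u = 0) (hw : fderiv ℝ f p w = 0) :
      θ ![L (fderiv ℝ σ.coord p u), w] = θ ![u, w] := by
    have hrad : θ ![L (fderiv ℝ σ.coord p u) - u, w] = 0 := by
      refine (hchar p hp _ ?_).1 ?_ w hw
      · rw [map_sub, hLf, hu, sub_zero]
      · rw [map_sub, hLc, sub_self]
    rwa [θ.map_vecCons_sub, sub_eq_zero] at hrad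
  rw [← hLθ]
  refine (compContinuousLinearMap_pair θ L _ _).trans ?_
  rw [hleft _ _ hu (hLf _), altForm_swap, hleft _ _ hv hu, ← altForm_swap]

theorem pullback_reducedForm (h : IsSliceAtlas hq slice)
    (hG : PreservesForm G θ (f ⁻¹' {y})) (hslice : ∀ x, (slice x).IsCharacteristic θ)
    (hf : Differentiable ℝ f) {γ : M → f ⁻¹' {y}} {z : M}
    (hγ : ContMDiffAt 𝓘(ℝ, V) 𝓘(ℝ, E) ∞ (fun z => (γ z : E)) z) :
    ((reducedForm θ slice).pullback (orbitProj G _ ∘ γ) : TwoForm V M) z =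
      (TwoForm.pullback (fun z => (γ z : E)) (fun _ => θ : VectorSpaceTwoForm E) :
        TwoForm V M) z := by
  have htangent := fderiv_mfderiv_eq_zero (hf (γ z)) (hγ.mdifferentiableAt (by simp))
  let Dγ : V →L[ℝ] E := mfderiv 𝓘(ℝ, V) 𝓘(ℝ, E) (fun z => (γ z : E)) z
  refine altForm_ext (F := V) fun u v => ?_
  calc ((reducedForm θ slice).pullback (orbitProj G _ ∘ γ) : TwoForm V M) z ![u, v]
      = (reducedForm θ slice (orbitProj G _ (γ z)) : AltForm W)
          ![mfderiv 𝓘(ℝ, V) 𝓘(ℝ, W) (orbitProj G _ ∘ γ) z u,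
            mfderiv 𝓘(ℝ, V) 𝓘(ℝ, W) (orbitProj G _ ∘ γ) z v] :=
        compContinuousLinearMap_pair (E := V) (F := W) _ _ u v
    _ = (reducedForm θ slice (orbitProj G _ (γ z)) : AltForm W)
          ![fderiv ℝ (slice (orbitProj G _ (γ z))).coord (γ z) (Dγ u),
            fderiv ℝ (slice (orbitProj G _ (γ z))).coord (γ z) (Dγ v)] :=
        congrArg₂ (fun a b : W => (reducedForm θ slice (orbitProj G _ (γ z)) : AltForm W) ![a, b])
          (h.mfderiv_proj_comp hγ u) (h.mfderiv_proj_comp hγ v)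
    _ = θ ![Dγ u, Dγ v] :=
        h.reducedForm_fderiv_coord hG hslice (hf (γ z)) (htangent u) (htangent v)
    _ = (TwoForm.pullback (fun z => (γ z : E)) (fun _ => θ : VectorSpaceTwoForm E) :
          TwoForm V M) z ![u, v] := (compContinuousLinearMap_pair (E := V) θ _ u v).symm

theorem reducedForm_nondegenerate (h : IsSliceAtlas hq slice)
    (hG : PreservesForm G θ (f ⁻¹' {y})) (hslice : ∀ x, (slice x).IsCharacteristic θ)
    (hf : Differentiable ℝ f) (x : OrbitSpace G (f ⁻¹' {y})) {u : W}
    (hu : ∀ v, (reducedForm θ slice x : AltForm W) ![u, v] = 0) : u = 0 := by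
  obtain ⟨p, rfl⟩ := hq.surjective x
  have hp := h.mem_dom p
  obtain ⟨L, hLf, hLc, -⟩ := (slice (orbitProj G _ p)).exists_tangent_lift hG (hf p) hp
  rw [← hLc u]
  refine (hslice _ p hp _ (hLf u)).2 fun v hv => ?_
  rw [← h.reducedForm_fderiv_coord hG hslice (hf p) (hLf u) hv, hLc]
  exact hu _

theorem isSymplecticForm_reducedForm (h : IsSliceAtlas hq slice)
    (hG : PreservesForm G θ (f ⁻¹' {y})) (hslice : ∀ x, (slice x).IsCharacteristic θ)
    (hf : Differentiable ℝ f) : IsSymplecticForm (reducedForm θ slice) := by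
  have hchart (x : OrbitSpace G (f ⁻¹' {y})) : EqOn
      ((reducedForm θ slice).inChart ((slice x).chart hq))
      (fun w => θ.compContinuousLinearMap (fderiv ℝ (fun w => ((slice x).lift w : E)) w))
      (slice x).target := fun w hw =>
    (h.pullback_reducedForm hG hslice hf ((slice x).contDiffAt_lift hw).contMDiffAt).trans
      (congrArg θ.compContinuousLinearMap mfderiv_eq_fderiv)
  refine ⟨?_, ?_, fun x u => h.reducedForm_nondegenerate hG hslice hf x⟩
  · rw [h.atlas_eq]
    rintro _ ⟨x, rfl⟩
    exact ((contDiff_compContinuousLinearMap θ).comp_contDiffOn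
      ((slice x).contDiffOn_lift.fderiv_of_isOpen (slice x).isOpen_target (by simp))).congr
        (hchart x)
  · rw [h.atlas_eq]
    rintro _ ⟨x, rfl⟩ w hw
    rw [((hchart x).eventuallyEq_of_mem ((slice x).isOpen_target.mem_nhds hw)).extDeriv_eq]
    exact extDeriv_pullback_const θ ((slice x).contDiffAt_lift hw)

end LevelSet

end IsSliceAtlas

theorem hasReducedSymplecticForm_of_localSlices {m n : ℕ} [SecondCountableTopology E]
    (hf : Differentiable ℝ f) (hG : PreservesForm G θ (f ⁻¹' {y}))
    (hT2 : T2Space (OrbitSpace G (f ⁻¹' {y})))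
    (hchart : ∀ p : f ⁻¹' {y}, ∃ σ : LocalSlice (id : f ⁻¹' {y} → f ⁻¹' {y})
      (EuclideanSpace ℝ (Fin m)), (p : E) ∈ σ.dom)
    (hslice : ∀ p : f ⁻¹' {y}, ∃ σ : LocalSlice (orbitProj G (f ⁻¹' {y}))
      (EuclideanSpace ℝ (Fin n)), (p : E) ∈ σ.dom ∧ σ.IsCharacteristic θ) :
    HasReducedSymplecticForm G (f ⁻¹' {y}) (fun _ => θ) m n := by
  have hq := hG.isOpenQuotientMap_orbitProj
  choose chart hchart using hchart
  have hslice' (x : OrbitSpace G (f ⁻¹' {y})) : ∃ σ : LocalSlice (orbitProj G (f ⁻¹' {y}))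
      (EuclideanSpace ℝ (Fin n)),
        (∀ p, orbitProj G _ p = x → (p : E) ∈ σ.dom) ∧ σ.IsCharacteristic θ := by
    obtain ⟨p, rfl⟩ := hq.surjective x
    obtain ⟨σ, hp, hσ⟩ := hslice p
    exact ⟨σ, fun p' hp' => σ.mem_dom_of_proj_eq p p' hp'.symm hp, hσ⟩
  choose slice hdom hslice using hslice'
  obtain ⟨_, hS⟩ := exists_isSliceAtlas IsOpenQuotientMap.id chart hchart
  obtain ⟨_, h⟩ := exists_isSliceAtlas hq slice fun p => hdom _ p rfl
  have hred := h.isSmoothReduction hS hG hT2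
  have hpull : ((reducedForm θ slice).pullback (orbitProj G _) : TwoForm _ (f ⁻¹' {y})) =
      TwoForm.pullback Subtype.val (fun _ => θ : VectorSpaceTwoForm E) :=
    funext fun p => h.pullback_reducedForm (γ := id) hG hslice hf (hS.contMDiff_val p)
  exact ⟨_, _, hred, reducedForm θ slice,
    ⟨h.isSymplecticForm_reducedForm hG hslice hf, hpull⟩, fun σ' hσ' =>
      twoForm_eq_of_pullback_eq hq.surjective hred.submersion_proj (hσ'.2.trans hpull.symm)⟩

end Reduction

/-! ### Slices on level sets -/

theorem exists_bijective_prod {E F W : Type*} [NormedAddCommGroup E] [NormedSpace ℝ E]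
    [FiniteDimensional ℝ E] [NormedAddCommGroup F] [NormedSpace ℝ F] [FiniteDimensional ℝ F]
    [NormedAddCommGroup W] [NormedSpace ℝ W] [FiniteDimensional ℝ W] {L : E →L[ℝ] F}
    (hL : Function.Surjective L)
    (hfinrank : Module.finrank ℝ E = Module.finrank ℝ F + Module.finrank ℝ W) :
    ∃ π : E →L[ℝ] W, Function.Bijective (L.prod π) := by
  have hker : Module.finrank ℝ (LinearMap.ker (L : E →ₗ[ℝ] F)) = Module.finrank ℝ W := by
    have hrank := (L : E →ₗ[ℝ] F).finrank_range_add_finrank_ker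
    rw [LinearMap.range_eq_top.2 hL, finrank_top] at hrank
    lia
  let e : LinearMap.ker (L : E →ₗ[ℝ] F) ≃ₗ[ℝ] W := LinearEquiv.ofFinrankEq _ _ hker
  obtain ⟨π, hπ⟩ := LinearMap.exists_extend (e : LinearMap.ker (L : E →ₗ[ℝ] F) →ₗ[ℝ] W)
  refine ⟨π.toContinuousLinearMap, ?_⟩
  have hinj : Function.Injective (L.prod π.toContinuousLinearMap) := by
    refine (injective_iff_map_eq_zero _).2 fun v hv => ?_
    have hLv : L v = 0 := congrArg Prod.fst hv
    have hπv : π v = 0 := congrArg Prod.snd hv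
    have hev : e ⟨v, hLv⟩ = 0 := (DFunLike.congr_fun hπ ⟨v, hLv⟩).symm.trans hπv
    exact congrArg Subtype.val ((map_eq_zero_iff e e.injective).1 hev)
  exact ⟨hinj, (LinearMap.injective_iff_surjective_of_finrank_eq_finrank
    (f := (L.prod π.toContinuousLinearMap : E →ₗ[ℝ] F × W))
    (hfinrank.trans Module.finrank_prod.symm)).1 hinj⟩

section LevelSets

open Set

variable {E F W X : Type*} [NormedAddCommGroup E] [NormedSpace ℝ E] [CompleteSpace E]
  [NormedAddCommGroup F] [NormedSpace ℝ F] [FiniteDimensional ℝ F]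
  [NormedAddCommGroup W] [NormedSpace ℝ W] [FiniteDimensional ℝ W] {f : E → F} {y : F}

theorem LocalSlice.exists_of_surjective_prod {q : f ⁻¹' {y} → X} {U : Set E} {c : E → W}
    (hf : ContDiff ℝ ∞ f) (hU : IsOpen U) (hc : ContDiffOn ℝ ∞ c U) {p : f ⁻¹' {y}}
    (hp : (p : E) ∈ U) (hsurj : Function.Surjective ((fderiv ℝ f p).prod (fderiv ℝ c p)))
    (hsat : ∀ p p' : f ⁻¹' {y}, q p = q p' → (p : E) ∈ U → (p' : E) ∈ U)
    (hfib : ∀ p p' : f ⁻¹' {y}, (p : E) ∈ U → (p' : E) ∈ U → (q p = q p' ↔ c p = c p')) :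
    ∃ σ : LocalSlice q W, (p : E) ∈ σ.dom ∧ σ.dom ⊆ U ∧ σ.coord = c := by
  classical
  have hcp : DifferentiableAt ℝ c p := (hc.contDiffAt (hU.mem_nhds hp)).differentiableAt (by simp)
  rw [← (hf.differentiable (by simp) p).fderiv_prodMk hcp] at hsurj
  obtain ⟨V, hV, hpV, s, hs, -, hsU, hright⟩ :=
    exists_contDiffOn_localSection hU (hf.contDiffOn.prodMk hc) hp hsurj
  have hsy {w : W} (hw : (y, w) ∈ V) : f (s (y, w)) = y := congrArg Prod.fst (hright hw)
  have hsc {w : W} (hw : (y, w) ∈ V) : c (s (y, w)) = w := congrArg Prod.snd (hright hw)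
  have hV' : IsOpen {w | (y, w) ∈ V} := hV.preimage (by fun_prop)
  have hlift {w : W} (hw : (y, w) ∈ V) :
      ((if h : (y, w) ∈ V then ⟨s (y, w), hsy h⟩ else p : f ⁻¹' {y}) : E) = s (y, w) := by
    rw [dif_pos hw]
  refine ⟨{
    dom := U ∩ c ⁻¹' {w | (y, w) ∈ V}
    coord := c
    target := {w | (y, w) ∈ V}
    lift w := if h : (y, w) ∈ V then ⟨s (y, w), hsy h⟩ else p
    isOpen_dom := hc.continuousOn.isOpen_inter_preimage hU hV'
    isOpen_target := hV'
    contDiffOn_coord := hc.mono inter_subset_left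
    contDiffOn_lift := (hs.comp (f := fun w => (y, w)) (contDiff_prodMk_right y).contDiffOn
      fun _ => id).congr fun _ hw => hlift hw
    coord_mem_target p hp := hp.2
    lift_mem_dom w hw := by
      rw [hlift hw]
      exact ⟨hsU hw, by rwa [mem_preimage, hsc hw]⟩
    coord_lift w hw := by rw [hlift hw, hsc hw]
    mem_dom_of_proj_eq p p' h hp := by
      have hp' := hsat p p' h hp.1
      exact ⟨hp', by rw [mem_preimage, ← (hfib p p' hp.1 hp').1 h]; exact hp.2⟩
    proj_eq_iff p p' hp hp' := hfib p p' hp.1 hp'.1 }, ⟨hp, ?_⟩, inter_subset_left, rfl⟩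
  have hpy : f p = y := p.2
  rwa [hpy] at hpV

theorem LocalSlice.exists_of_surjective_fderiv [FiniteDimensional ℝ E] (hf : ContDiff ℝ ∞ f)
    (p : f ⁻¹' {y}) (hsurj : Function.Surjective (fderiv ℝ f p))
    (hfinrank : Module.finrank ℝ E = Module.finrank ℝ F + Module.finrank ℝ W) :
    ∃ σ : LocalSlice (id : f ⁻¹' {y} → f ⁻¹' {y}) W, (p : E) ∈ σ.dom := by
  obtain ⟨π, hπ⟩ := exists_bijective_prod hsurj hfinrank
  have hsmooth : ContDiffAt ℝ ∞ (fun x => (f x, π x)) p :=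
    hf.contDiffAt.prodMk π.contDiff.contDiffAt
  let L := (LinearEquiv.ofBijective _ hπ).toContinuousLinearEquiv
  have hderiv : HasFDerivAt (fun x => (f x, π x)) (L : E →L[ℝ] F × W) p :=
    (hf.differentiable (by simp) p).hasFDerivAt.prodMk π.hasFDerivAt
  let e := hsmooth.toOpenPartialHomeomorph _ hderiv (by simp)
  have hinj : InjOn (fun x => (f x, π x)) e.source := e.injOn
  obtain ⟨σ, hσ, -, -⟩ := LocalSlice.exists_of_surjective_prod (q := (id : f ⁻¹' {y} → _)) hf
    e.open_source π.contDiff.contDiffOn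
    (hsmooth.mem_toOpenPartialHomeomorph_source hderiv (by simp))
    (by rw [π.fderiv]; exact hπ.surjective)
    (fun p p' h hp => (show p = p' from h) ▸ hp) fun p p' hp hp' =>
      ⟨fun h => congrArg (fun p : f ⁻¹' {y} => π p) h, fun h =>
        Subtype.ext (hinj hp hp' (Prod.ext (p.2.trans p'.2.symm) h))⟩
  exact ⟨σ, hσ⟩

end LevelSets

/-! ### Calculus of matrix-valued functions -/

section MatrixCalculus

variable {𝕜 E 𝔸 l m n : Type*} [NontriviallyNormedField 𝕜] [NormedAddCommGroup E] [NormedSpace 𝕜 E]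
  [Fintype l] [Fintype m] [Fintype n] {r : WithTop ℕ∞} {x : E}

theorem contDiffAt_matrix [NormedAddCommGroup 𝔸] [NormedSpace 𝕜 𝔸] {A : E → Matrix m n 𝔸} :
    ContDiffAt 𝕜 r A x ↔ ∀ i j, ContDiffAt 𝕜 r (fun y => A y i j) x :=
  contDiffAt_pi.trans (forall_congr' fun _ => contDiffAt_pi)

theorem contDiffAt_matrix_mul [NormedRing 𝔸] [NormedAlgebra 𝕜 𝔸] {A : E → Matrix l m 𝔸}
    {B : E → Matrix m n 𝔸} (hA : ContDiffAt 𝕜 r A x) (hB : ContDiffAt 𝕜 r B x) :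
    ContDiffAt 𝕜 r (fun y => A y * B y) x :=
  contDiffAt_matrix.2 fun i j => ContDiffAt.sum fun k _ =>
    (contDiffAt_matrix.1 hA i k).mul (contDiffAt_matrix.1 hB k j)

theorem contDiffAt_matrix_det [DecidableEq n] [NormedCommRing 𝔸] [NormedAlgebra 𝕜 𝔸]
    {A : E → Matrix n n 𝔸} (hA : ContDiffAt 𝕜 r A x) : ContDiffAt 𝕜 r (fun y => (A y).det) x := by
  simp only [Matrix.det_apply']
  exact ContDiffAt.sum fun σ _ =>
    contDiffAt_const.mul (contDiffAt_prod fun i _ => contDiffAt_matrix.1 hA (σ i) i)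

theorem contDiffAt_matrix_adjugate [DecidableEq n] [NormedCommRing 𝔸] [NormedAlgebra 𝕜 𝔸]
    {A : E → Matrix n n 𝔸} (hA : ContDiffAt 𝕜 r A x) :
    ContDiffAt 𝕜 r (fun y => (A y).adjugate) x := by
  refine contDiffAt_matrix.2 fun i j => ?_
  simp only [Matrix.adjugate_apply]
  refine contDiffAt_matrix_det (contDiffAt_matrix.2 fun a b => ?_)
  simp only [Matrix.updateRow_apply]
  split_ifs
  · exact contDiffAt_const
  · exact contDiffAt_matrix.1 hA a b

theorem contDiffAt_matrix_inv [DecidableEq n] [NormedField 𝔸] [NormedAlgebra 𝕜 𝔸]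
    {A : E → Matrix n n 𝔸} (hA : ContDiffAt 𝕜 r A x) (h0 : (A x).det ≠ 0) :
    ContDiffAt 𝕜 r (fun y => (A y)⁻¹) x := by
  simp only [Matrix.inv_def, Ring.inverse_eq_inv']
  exact ((contDiffAt_matrix_det hA).inv h0).smul (contDiffAt_matrix_adjugate hA)

theorem fderiv_matrix_apply [NormedAddCommGroup 𝔸] [NormedSpace 𝕜 𝔸] {A : E → Matrix m n 𝔸}
    (hA : ContDiffAt 𝕜 1 A x) (v : E) (i : m) (j : n) :
    fderiv 𝕜 A x v i j = fderiv 𝕜 (fun y => A y i j) x v := by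
  have hrow : HasFDerivAt (fun y => A y i) _ x :=
    hasFDerivAt_pi'.1 (hA.differentiableAt one_ne_zero).hasFDerivAt i
  have hentry : HasFDerivAt (fun y => A y i j) _ x := hasFDerivAt_pi'.1 hrow j
  rw [hentry.fderiv]
  rfl

theorem fderiv_matrix_mul [NormedRing 𝔸] [NormedAlgebra 𝕜 𝔸] {A : E → Matrix l m 𝔸}
    {B : E → Matrix m n 𝔸} (hA : ContDiffAt 𝕜 1 A x) (hB : ContDiffAt 𝕜 1 B x) (v : E) :
    fderiv 𝕜 (fun y => A y * B y) x v = A x * fderiv 𝕜 B x v + fderiv 𝕜 A x v * B x := by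
  have hA' i k : DifferentiableAt 𝕜 (fun y => A y i k) x :=
    (contDiffAt_matrix.1 hA i k).differentiableAt one_ne_zero
  have hB' k j : DifferentiableAt 𝕜 (fun y => B y k j) x :=
    (contDiffAt_matrix.1 hB k j).differentiableAt one_ne_zero
  ext i j
  have hsum : fderiv 𝕜 (fun y => ∑ k, A y i k * B y k j) x =
      ∑ k, (A x i k • fderiv 𝕜 (fun y => B y k j) x +
        MulOpposite.op (B x k j) • fderiv 𝕜 (fun y => A y i k) x) := by
    rw [fderiv_fun_sum fun k _ => (hA' i k).fun_mul (hB' k j)]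
    exact Finset.sum_congr rfl fun k _ => fderiv_fun_mul' (hA' i k) (hB' k j)
  refine (fderiv_matrix_apply (contDiffAt_matrix_mul hA hB) v i j).trans
    ((DFunLike.congr_fun hsum v).trans ?_)
  simp [Matrix.mul_apply, fderiv_matrix_apply hA, fderiv_matrix_apply hB, Finset.sum_add_distrib]

end MatrixCalculus

section ConjTranspose

variable {𝔸 m n : Type*} [SeminormedAddCommGroup 𝔸] [StarAddMonoid 𝔸] [NormedStarGroup 𝔸]
  [Module ℝ 𝔸] [StarModule ℝ 𝔸]

/-- Conjugate transposition, as a continuous real-linear map. -/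
def conjTransposeCLM : Matrix m n 𝔸 →L[ℝ] Matrix n m 𝔸 where
  toFun A := Aᴴ
  map_add' := Matrix.conjTranspose_add
  map_smul' c A := by rw [Matrix.conjTranspose_smul, star_trivial, RingHom.id_apply]
  cont := continuous_id.matrix_conjTranspose

end ConjTranspose

/-! ### The Hamiltonian action on matrices -/

section Symplectic

variable {d N : ℕ}

theorem stdAlt_apply (X Y : Matrix (Fin d) (Fin N) ℂ) :
    stdAlt d N ![X, Y] = -(Yᴴ * X).trace.im := rfl

theorem eq_zero_of_re_trace_conjTranspose_mul_self {m n : Type*} [Fintype m] [Fintype n]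
    {X : Matrix m n ℂ} (h : (Xᴴ * X).trace.re = 0) : X = 0 := by
  have hnonneg := (Matrix.posSemidef_conjTranspose_mul_self X).trace_nonneg
  exact Matrix.trace_conjTranspose_mul_self_eq_zero_iff.1
    (Complex.ext h (Complex.nonneg_iff.1 hnonneg).2.symm)

theorem stdAlt_I_smul_right (X : Matrix (Fin d) (Fin N) ℂ) :
    stdAlt d N ![X, Complex.I • X] = (Xᴴ * X).trace.re := by
  simp [stdAlt_apply, Matrix.conjTranspose_smul, Matrix.trace_smul]

theorem eq_zero_of_stdAlt_I_smul_right {X : Matrix (Fin d) (Fin N) ℂ}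
    (h : stdAlt d N ![X, Complex.I • X] = 0) : X = 0 :=
  eq_zero_of_re_trace_conjTranspose_mul_self ((stdAlt_I_smul_right X).symm.trans h)

theorem isSymplecticForm_stdForm (d N : ℕ) : IsSymplecticForm (stdForm d N) :=
  isSymplecticForm_const fun X h => eq_zero_of_stdAlt_I_smul_right (h (Complex.I • X))

theorem conjTranspose_lieU (ξ : LieU d) : ξ.1ᴴ = -ξ.1 := ξ.2

theorem conjTranspose_herm (K : Herm d) : K.1ᴴ = K.1 := K.2

theorem alpha_apply (K : Herm d) (η : LieU d) : alpha d K η = -(η.1ᴴ * K.1).trace.im / 2 := by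
  change (Complex.I / 2 * (η.1ᴴ * K.1).trace).re = _
  rw [div_mul_eq_mul_div, Complex.div_ofNat_re, Complex.I_mul_re]

/-- Multiplication by `i`, as an isomorphism from Hermitian to skew-Hermitian matrices. -/
noncomputable def hermEquivLieU (d : ℕ) : Herm d ≃ₗ[ℝ] LieU d where
  toFun K := ⟨Complex.I • K.1, by
    change _ᴴ = -_
    rw [Matrix.conjTranspose_smul, conjTranspose_herm]
    simp⟩
  invFun η := ⟨-Complex.I • η.1, by
    change _ᴴ = _
    rw [Matrix.conjTranspose_smul, conjTranspose_lieU]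
    simp⟩
  map_add' K L := by ext1; simp
  map_smul' c K := by ext1; exact smul_comm Complex.I c K.1
  left_inv K := by ext1; simp [smul_smul]
  right_inv η := by ext1; simp [smul_smul]

theorem alpha_hermEquivLieU (K : Herm d) :
    alpha d K (hermEquivLieU d K) = (K.1ᴴ * K.1).trace.re / 2 := by
  have hcoe : (hermEquivLieU d K).1 = Complex.I • K.1 := rfl
  simp [alpha_apply, hcoe, Matrix.conjTranspose_smul, Matrix.trace_smul]

theorem alpha_injective (d : ℕ) : Function.Injective (alpha d) := by
  refine (injective_iff_map_eq_zero _).2 fun K hK => Subtype.ext ?_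
  have hre := alpha_hermEquivLieU K
  rw [hK, LinearMap.zero_apply] at hre
  exact eq_zero_of_re_trace_conjTranspose_mul_self (by linarith)

theorem finrank_real_matrix (d N : ℕ) :
    Module.finrank ℝ (Matrix (Fin d) (Fin N) ℂ) = 2 * d * N := by
  rw [Module.finrank_matrix, Complex.finrank_real_complex, Fintype.card_fin, Fintype.card_fin]
  ring

theorem finrank_herm (d : ℕ) : Module.finrank ℝ (Herm d) = d ^ 2 := by
  have hsum : Module.finrank ℝ (Matrix (Fin d) (Fin d) ℂ) = Module.finrank ℝ (Herm d × LieU d) :=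
    (StarModule.decomposeProdAdjoint ℝ (Matrix (Fin d) (Fin d) ℂ)).finrank_eq
  rw [Module.finrank_prod, finrank_real_matrix, ← (hermEquivLieU d).finrank_eq] at hsum
  linarith

theorem alpha_bijective (d : ℕ) : Function.Bijective (alpha d) := by
  refine ⟨alpha_injective d, (LinearMap.injective_iff_surjective_of_finrank_eq_finrank ?_).1
    (alpha_injective d)⟩
  rw [Subspace.dual_finrank_eq, (hermEquivLieU d).finrank_eq]

end Symplectic

section Action

variable {d N : ℕ}

theorem unitary_conjTranspose_mul (A : U d) : A.1ᴴ * A.1 = 1 := Matrix.mem_unitaryGroup_iff'.1 A.2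

theorem unitary_mul_conjTranspose (A : U d) : A.1 * A.1ᴴ = 1 := Matrix.mem_unitaryGroup_iff.1 A.2

theorem unitary_smul_eq_mul (A : U d) (F : Matrix (Fin d) (Fin N) ℂ) : A • F = A.1 * F := rfl

theorem contDiff_unitary_smul (A : U d) :
    ContDiff ℝ ∞ fun F : Matrix (Fin d) (Fin N) ℂ => A • F :=
  contDiff_iff_contDiffAt.2 fun _ => contDiffAt_matrix_mul contDiffAt_const contDiffAt_id

theorem fderiv_unitary_smul (A : U d) (F T : Matrix (Fin d) (Fin N) ℂ) :
    fderiv ℝ (fun F : Matrix (Fin d) (Fin N) ℂ => A • F) F T = A.1 * T := by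
  have hmul := fderiv_matrix_mul (𝕜 := ℝ) (x := F) (contDiffAt_const (c := A.1)) contDiffAt_id T
  have hconst : fderiv ℝ (fun _ : Matrix (Fin d) (Fin N) ℂ => A.1) F T = 0 :=
    DFunLike.congr_fun (hasFDerivAt_const A.1 F).fderiv T
  have hid : fderiv ℝ id F T = T := DFunLike.congr_fun (hasFDerivAt_id F).fderiv T
  refine hmul.trans ((congrArg₂ (fun S R => A.1 * S + R * F) hid hconst).trans ?_)
  rw [Matrix.zero_mul, add_zero]

theorem stdAlt_pullback_unitary_smul (A : U d) (F : Matrix (Fin d) (Fin N) ℂ) :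
    (stdAlt d N).compContinuousLinearMap (fderiv ℝ (fun F : Matrix (Fin d) (Fin N) ℂ => A • F) F) =
      stdAlt d N := by
  refine altForm_ext fun X Y => ?_
  refine (compContinuousLinearMap_pair (stdAlt d N) _ X Y).trans <|
    (congrArg₂ (fun S R => stdAlt d N ![S, R]) (fderiv_unitary_smul A F X)
      (fderiv_unitary_smul A F Y)).trans ?_
  rw [stdAlt_apply, stdAlt_apply, Matrix.conjTranspose_mul, Matrix.mul_assoc,
    ← Matrix.mul_assoc A.1ᴴ, unitary_conjTranspose_mul, Matrix.one_mul]

theorem hasDerivAt_map_exp_smul_zero {𝔸 V : Type*} [NormedRing 𝔸] [NormedAlgebra ℝ 𝔸]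
    [FiniteDimensional ℝ 𝔸] [NormedAddCommGroup V] [NormedSpace ℝ V] (L : 𝔸 →ₗ[ℝ] V) (ξ : 𝔸) :
    HasDerivAt (fun t : ℝ => L (NormedSpace.exp (t • ξ))) (L ξ) 0 := by
  have : CompleteSpace 𝔸 := FiniteDimensional.complete ℝ 𝔸
  have hexp := hasDerivAt_exp_smul_const (𝕂 := ℝ) ξ 0
  rw [zero_smul, NormedSpace.exp_zero, one_mul] at hexp
  exact L.toContinuousLinearMap.hasFDerivAt.comp_hasDerivAt 0 hexp

-- Differentiating `exp` needs a submultiplicative norm, which the elementwise norm is not.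
theorem hasDerivAt_matrix_exp_smul_apply_zero (ξ : Matrix (Fin d) (Fin d) ℂ) (i j : Fin d) :
    HasDerivAt (fun t : ℝ => NormedSpace.exp (t • ξ) i j) (ξ i j) 0 :=
  @hasDerivAt_map_exp_smul_zero (Matrix (Fin d) (Fin d) ℂ) ℂ Matrix.linftyOpNormedRing
    Matrix.linftyOpNormedAlgebra inferInstance _ _ (Matrix.entryLinearMap ℝ ℂ i j) ξ

theorem fundamentalField_eq_mul (ξ : LieU d) (F : Matrix (Fin d) (Fin N) ℂ) :
    fundamentalField ξ F = ξ.1 * F :=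
  HasDerivAt.deriv <| hasDerivAt_pi.2 fun i => hasDerivAt_pi.2 fun j =>
    HasDerivAt.fun_sum (u := Finset.univ) (A := fun k t => NormedSpace.exp (t • ξ.1) i k * F k j)
      fun k _ => (hasDerivAt_matrix_exp_smul_apply_zero ξ.1 i k).mul_const (F k j)

end Action

section Momentum

variable {d N : ℕ}

theorem momentum_coe (F : Matrix (Fin d) (Fin N) ℂ) : (momentum d N F).1 = -(F * Fᴴ) := rfl

theorem contDiff_mul_conjTranspose {m n : Type*} [Fintype m] [Fintype n] :
    ContDiff ℝ ∞ fun F : Matrix m n ℂ => F * Fᴴ :=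
  contDiff_iff_contDiffAt.2 fun _ =>
    contDiffAt_matrix_mul contDiffAt_id
      (conjTransposeCLM (m := m) (n := n) (𝔸 := ℂ)).contDiff.contDiffAt

theorem contDiff_momentum (d N : ℕ) : ContDiff ℝ ∞ (momentum d N) := by
  let hermPart : Matrix (Fin d) (Fin d) ℂ →L[ℝ] Herm d :=
    LinearMap.toContinuousLinearMap (selfAdjointPart ℝ)
  have hmomentum : momentum d N = fun F => hermPart (-(F * Fᴴ)) := funext fun F =>
    Subtype.ext (IsSelfAdjoint.coe_selfAdjointPart_apply ℝ (conjTranspose_herm _)).symm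
  rw [hmomentum]
  exact hermPart.contDiff.comp contDiff_mul_conjTranspose.neg

theorem fderiv_momentum_coe (F T : Matrix (Fin d) (Fin N) ℂ) :
    (fderiv ℝ (momentum d N) F T).1 = -(F * Tᴴ + T * Fᴴ) := by
  have hcoe : (fderiv ℝ (momentum d N) F T).1 = fderiv ℝ (fun F => -(F * Fᴴ)) F T :=
    (DFunLike.congr_fun ((Herm d).subtypeL.hasFDerivAt.comp F
      ((contDiff_momentum d N).differentiable (by simp) F).hasFDerivAt).fderiv T).symm
  have hneg : fderiv ℝ (fun F : Matrix (Fin d) (Fin N) ℂ => -(F * Fᴴ)) F T =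
      -fderiv ℝ (fun F : Matrix (Fin d) (Fin N) ℂ => F * Fᴴ) F T :=
    DFunLike.congr_fun fderiv_fun_neg T
  have hmul := fderiv_matrix_mul (𝕜 := ℝ) (x := F) contDiffAt_id
    (conjTransposeCLM (𝔸 := ℂ)).contDiff.contDiffAt T
  have hconj : fderiv ℝ (conjTransposeCLM (m := Fin d) (n := Fin N) (𝔸 := ℂ)) F T = Tᴴ :=
    DFunLike.congr_fun (ContinuousLinearMap.hasFDerivAt _).fderiv T
  have hid : fderiv ℝ id F T = T := DFunLike.congr_fun (hasFDerivAt_id F).fderiv T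
  exact hcoe.trans <| hneg.trans <| congrArg Neg.neg <|
    hmul.trans (congrArg₂ (fun S R => F * S + R * Fᴴ) hconj hid)

theorem fderiv_momentum_eq_zero_iff {F T : Matrix (Fin d) (Fin N) ℂ} :
    fderiv ℝ (momentum d N) F T = 0 ↔ F * Tᴴ + T * Fᴴ = 0 :=
  Subtype.ext_iff.trans <| (fderiv_momentum_coe F T).congr_left.trans neg_eq_zero

theorem momentum_smul_coe (A : U d) (F : Matrix (Fin d) (Fin N) ℂ) :
    (momentum d N (A • F)).1 = A.1 * (momentum d N F).1 * A.1ᴴ := by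
  simp only [momentum_coe, unitary_smul_eq_mul, Matrix.conjTranspose_mul, Matrix.mul_neg,
    Matrix.neg_mul, Matrix.mul_assoc]

theorem alpha_eq_coadU_alpha {A : U d} {K L : Herm d} (h : L.1 = A.1 * K.1 * A.1ᴴ) :
    alpha d L = coadU A (alpha d K) := by
  ext η
  have hη : (adU A⁻¹ η).1 = A.1ᴴ * η.1 * A.1 := by
    change A.1ᴴ * η.1 * A.1ᴴᴴ = _
    rw [Matrix.conjTranspose_conjTranspose]
  have htrace : (η.1ᴴ * L.1).trace = ((adU A⁻¹ η).1ᴴ * K.1).trace := by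
    rw [hη, h, Matrix.conjTranspose_mul, Matrix.conjTranspose_mul,
      Matrix.conjTranspose_conjTranspose, ← Matrix.mul_assoc, Matrix.trace_mul_comm]
    simp only [Matrix.mul_assoc]
  rw [alpha_apply, htrace]
  exact (alpha_apply K (adU A⁻¹ η)).symm

theorem stdAlt_lieU_mul (ξ : LieU d) (F Y : Matrix (Fin d) (Fin N) ℂ) :
    stdAlt d N ![ξ.1 * F, Y] = alpha d (fderiv ℝ (momentum d N) F Y) ξ := by
  set z := (ξ.1 * (F * Yᴴ)).trace with hz
  have hFY : (Yᴴ * (ξ.1 * F)).trace = z := by rw [Matrix.trace_mul_comm, Matrix.mul_assoc]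
  have hYF : (ξ.1 * (Y * Fᴴ)).trace = -star z := by
    rw [hz, ← Matrix.trace_conjTranspose, Matrix.conjTranspose_mul, Matrix.conjTranspose_mul,
      Matrix.conjTranspose_conjTranspose, conjTranspose_lieU, Matrix.mul_neg, Matrix.trace_neg,
      neg_neg, Matrix.trace_mul_comm]
  have htrace : (ξ.1ᴴ * (fderiv ℝ (momentum d N) F Y).1).trace = z - star z := by
    rw [conjTranspose_lieU, fderiv_momentum_coe, Matrix.neg_mul, Matrix.mul_neg, neg_neg,
      Matrix.mul_add, Matrix.trace_add, hYF, sub_eq_add_neg]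
  rw [stdAlt_apply, alpha_apply, hFY, htrace, Complex.sub_im, Complex.star_def, Complex.conj_im]
  ring

theorem isMomentumMap_momentum (d N : ℕ) :
    IsMomentumMap (stdForm d N) (fun F => alpha d (momentum d N F)) where
  smooth_action := ⟨fun x => x.1 * x.2, contDiff_iff_contDiffAt.2 fun _ =>
    contDiffAt_matrix_mul contDiffAt_fst contDiffAt_snd, fun _ _ => rfl⟩
  preserves_form A := funext fun F =>
    (congrArg (stdAlt d N).compContinuousLinearMap mfderiv_eq_fderiv).trans
      (stdAlt_pullback_unitary_smul A F)
  smooth ξ := ((alpha d).flip ξ).toContinuousLinearMap.contDiff.comp (contDiff_momentum d N)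
  hamilton ξ F Y := by
    have hderiv : HasFDerivAt (fun F => alpha d (momentum d N F) ξ)
        (((alpha d).flip ξ).toContinuousLinearMap ∘L fderiv ℝ (momentum d N) F) F :=
      ((alpha d).flip ξ).toContinuousLinearMap.hasFDerivAt.comp F
        ((contDiff_momentum d N).differentiable (by simp) F).hasFDerivAt
    exact (congrArg (fun X => stdAlt d N ![X, Y]) (fundamentalField_eq_mul ξ F)).trans <|
      (stdAlt_lieU_mul ξ F Y).trans (DFunLike.congr_fun hderiv.fderiv Y).symm
  equivariant A F := alpha_eq_coadU_alpha (momentum_smul_coe A F)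

end Momentum

/-! ### Regular values and tight frames -/

section RegularValues

variable {d N : ℕ}

theorem posDef_mul_conjTranspose_of_surjective_fderiv {F : Matrix (Fin d) (Fin N) ℂ}
    (hF : Function.Surjective (fderiv ℝ (momentum d N) F)) : (F * Fᴴ).PosDef := by
  obtain ⟨T, hT⟩ := hF ⟨1, Matrix.conjTranspose_one⟩
  have hone : (1 : Matrix (Fin d) (Fin d) ℂ) = -(F * Tᴴ + T * Fᴴ) :=
    (congrArg Subtype.val hT).symm.trans (fderiv_momentum_coe F T)
  refine .mul_conjTranspose_self F <|
    (injective_iff_map_eq_zero (Matrix.vecMulLinear F)).2 fun v (hv : v ᵥ* F = 0) => ?_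
  have hstar : Fᴴ *ᵥ star v = 0 := by rw [← Matrix.star_vecMul, hv, star_zero]
  have hnorm : v ⬝ᵥ ((1 : Matrix (Fin d) (Fin d) ℂ) *ᵥ star v) = 0 := by
    rw [hone, Matrix.neg_mulVec, Matrix.add_mulVec, ← Matrix.mulVec_mulVec, ← Matrix.mulVec_mulVec,
      hstar, Matrix.mulVec_zero, add_zero, dotProduct_neg, Matrix.dotProduct_mulVec, hv,
      zero_dotProduct, neg_zero]
  rwa [Matrix.one_mulVec, dotProduct_comm, dotProduct_star_self_eq_zero] at hnorm

theorem exists_fderiv_momentum_mul_eq {F : Matrix (Fin d) (Fin N) ℂ} (hF : (F * Fᴴ).PosDef)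
    (K : Herm d) : ∃ X : Matrix (Fin d) (Fin d) ℂ, fderiv ℝ (momentum d N) F (X * F) = K := by
  set B := F * Fᴴ with hB
  have hdet : IsUnit B.det := isUnit_iff_ne_zero.2 hF.det_pos.ne'
  let X := (-(1 / 2 : ℝ)) • (K.1 * B⁻¹)
  have hXF : X * F * Fᴴ = (-(1 / 2 : ℝ)) • K.1 := by
    rw [Matrix.mul_assoc, ← hB, Matrix.smul_mul, Matrix.nonsing_inv_mul_cancel_right _ _ hdet]
  have hFX : F * (X * F)ᴴ = (-(1 / 2 : ℝ)) • K.1 := by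
    rw [← Matrix.conjTranspose_conjTranspose F, ← Matrix.conjTranspose_mul,
      Matrix.conjTranspose_conjTranspose, hXF, Matrix.conjTranspose_smul, conjTranspose_herm,
      star_trivial]
  refine ⟨X, Subtype.ext ((fderiv_momentum_coe F (X * F)).trans ?_)⟩
  rw [hFX, hXF, ← add_smul, ← neg_smul]
  norm_num

theorem surjective_fderiv_momentum {F : Matrix (Fin d) (Fin N) ℂ} (hF : (F * Fᴴ).PosDef) :
    Function.Surjective (fderiv ℝ (momentum d N) F) := fun K =>
  (exists_fderiv_momentum_mul_eq hF K).imp' (· * F) fun _ => id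

theorem exists_mul_conjTranspose_eq_one (hdN : d ≤ N) :
    ∃ J : Matrix (Fin d) (Fin N) ℂ, J * Jᴴ = 1 := by
  refine ⟨Matrix.of fun i j => if Fin.castLE hdN i = j then 1 else 0, ?_⟩
  ext i j
  simp [Matrix.mul_apply, Matrix.one_apply, eq_comm (a := i)]

open scoped MatrixOrder in
theorem mem_range_momentum (hdN : d ≤ N) {K : Herm d} (hK : (-K.1).PosSemidef) :
    K ∈ Set.range (momentum d N) := by
  obtain ⟨J, hJ⟩ := exists_mul_conjTranspose_eq_one hdN
  obtain ⟨B, hB⟩ := CStarAlgebra.nonneg_iff_eq_star_mul_self.1 hK.nonneg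
  refine ⟨Bᴴ * J, Subtype.ext ?_⟩
  rw [momentum_coe, Matrix.conjTranspose_mul, Matrix.conjTranspose_conjTranspose, Matrix.mul_assoc,
    ← Matrix.mul_assoc J, hJ, Matrix.one_mul, ← Matrix.star_eq_conjTranspose, ← hB, neg_neg]

theorem isRegularValue_momentum_iff (hdN : d ≤ N) (K : Herm d) :
    IsRegularValue (momentum d N) K ↔ (-K.1).PosDef := by
  constructor
  · rintro ⟨⟨F, rfl⟩, hsurj⟩
    rw [momentum_coe, neg_neg]
    exact posDef_mul_conjTranspose_of_surjective_fderiv (hsurj F rfl)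
  · refine fun hK => ⟨mem_range_momentum hdN hK.posSemidef, ?_⟩
    rintro F rfl
    rw [momentum_coe, neg_neg] at hK
    exact surjective_fderiv_momentum hK

end RegularValues

section TightFrames

variable {d N : ℕ}

theorem sum_norm_inner_sq (F : Matrix (Fin d) (Fin N) ℂ) (v : EuclideanSpace ℂ (Fin d)) :
    ((∑ i, ‖inner ℂ v (WithLp.toLp 2 (fun k => F k i))‖ ^ 2 : ℝ) : ℂ) =
      inner ℂ (Matrix.toEuclideanLin (F * Fᴴ) v) v := by
  set u : Fin N → ℂ := Fᴴ *ᵥ v.ofLp with hu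
  have hgram : inner ℂ (Matrix.toEuclideanLin (F * Fᴴ) v) v = star u ⬝ᵥ u := by
    rw [EuclideanSpace.inner_eq_star_dotProduct, Matrix.ofLp_toLpLin,
      Matrix.toLin'_apply, ← Matrix.mulVec_mulVec, ← hu, Matrix.star_mulVec, dotProduct_comm,
      ← Matrix.dotProduct_mulVec]
  have hcolumn i : inner ℂ v (WithLp.toLp 2 (fun k => F k i)) = star (u i) := by
    simp [EuclideanSpace.inner_eq_star_dotProduct, hu, Matrix.mulVec, dotProduct]
  rw [hgram, dotProduct, Complex.ofReal_sum]
  refine Finset.sum_congr rfl fun i _ => ?_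
  rw [hcolumn, norm_star, Pi.star_apply, Complex.star_def, Complex.conj_mul', Complex.ofReal_pow]

theorem toEuclideanLin_smul_one (c : ℝ) :
    Matrix.toEuclideanLin (c • (1 : Matrix (Fin d) (Fin d) ℂ)) = (c : ℂ) • LinearMap.id := by
  ext v i
  simp [Matrix.smul_mulVec]

theorem mem_tightFrames_iff {c : ℝ} (hc : 0 < c) {F : Matrix (Fin d) (Fin N) ℂ} :
    F ∈ tightFrames d N c ↔ F * Fᴴ = c • (1 : Matrix (Fin d) (Fin d) ℂ) := by
  have hbounds : F ∈ tightFrames d N c ↔ ∀ v : EuclideanSpace ℂ (Fin d),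
      ((∑ i, ‖inner ℂ v (WithLp.toLp 2 (fun k => F k i))‖ ^ 2 : ℝ) : ℂ) = (c * ‖v‖ ^ 2 : ℝ) := by
    simp only [Complex.ofReal_inj]
    exact ⟨fun h v => le_antisymm (h.2.2 v).2 (h.2.2 v).1,
      fun h => ⟨hc, le_rfl, fun v => ⟨(h v).ge, (h v).le⟩⟩⟩
  have hnorm (v : EuclideanSpace ℂ (Fin d)) : ((c * ‖v‖ ^ 2 : ℝ) : ℂ) =
      inner ℂ (Matrix.toEuclideanLin (c • (1 : Matrix (Fin d) (Fin d) ℂ)) v) v := by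
    rw [toEuclideanLin_smul_one, LinearMap.smul_apply, LinearMap.id_apply, inner_smul_left,
      Complex.conj_ofReal, inner_self_eq_norm_sq_to_K]
    push_cast
    rfl
  simp only [hbounds, sum_norm_inner_sq, hnorm]
  exact (ext_inner_map _ _).trans Matrix.toEuclideanLin.injective.eq_iff

theorem tightFrames_eq_level {c : ℝ} (hc : 0 < c) : tightFrames d N c =
    {F | (momentum d N F : Matrix (Fin d) (Fin d) ℂ) = -(c • 1)} := by
  ext F
  rw [mem_tightFrames_iff hc, Set.mem_ofPred_eq, momentum_coe, neg_inj]

theorem smul_mem_tightFrames {c : ℝ} (hc : 0 < c) (A : U d) {F : Matrix (Fin d) (Fin N) ℂ}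
    (hF : F ∈ tightFrames d N c) : A • F ∈ tightFrames d N c := by
  rw [tightFrames_eq_level hc, Set.mem_ofPred_eq] at hF ⊢
  rw [momentum_smul_coe, hF, Matrix.mul_neg, Matrix.mul_smul, Matrix.mul_one, Matrix.neg_mul,
    Matrix.smul_mul, unitary_mul_conjTranspose]

theorem eq_one_of_smul_eq_of_mem_tightFrames {c : ℝ} (hc : 0 < c) (A : U d)
    {F : Matrix (Fin d) (Fin N) ℂ} (hF : F ∈ tightFrames d N c) (h : A • F = F) : A = 1 := by
  rw [mem_tightFrames_iff hc] at hF
  have hA : A.1 * (F * Fᴴ) = F * Fᴴ := by rw [← Matrix.mul_assoc, ← unitary_smul_eq_mul, h]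
  rw [hF, Matrix.mul_smul, Matrix.mul_one] at hA
  exact Subtype.ext (smul_right_injective _ hc.ne' hA)

end TightFrames

/-! ### Slices for tight frames -/

section GrassmannianCoordinates

variable {d N : ℕ} {F₀ F : Matrix (Fin d) (Fin N) ℂ}

/-- The matrix in the `GL(d)`-orbit of `F` whose product with `F₀ᴴ` is the identity; it represents
the row space of `F` in the affine chart of the Grassmannian around the row space of `F₀`. It is
meaningful only where `F * F₀ᴴ` is invertible. -/
noncomputable def affineCoord (F₀ F : Matrix (Fin d) (Fin N) ℂ) : Matrix (Fin d) (Fin N) ℂ :=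
  (F * F₀ᴴ)⁻¹ * F

theorem mul_affineCoord (hF : (F * F₀ᴴ).det ≠ 0) : F * F₀ᴴ * affineCoord F₀ F = F :=
  Matrix.mul_nonsing_inv_cancel_left _ _ hF.isUnit

theorem affineCoord_mul_conjTranspose (hF : (F * F₀ᴴ).det ≠ 0) : affineCoord F₀ F * F₀ᴴ = 1 := by
  rw [affineCoord, Matrix.mul_assoc, Matrix.nonsing_inv_mul _ hF.isUnit]

theorem affineCoord_mul_left {A : Matrix (Fin d) (Fin d) ℂ} (hA : A.det ≠ 0)
    (F₀ F : Matrix (Fin d) (Fin N) ℂ) : affineCoord F₀ (A * F) = affineCoord F₀ F := by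
  rw [affineCoord, Matrix.mul_assoc A, Matrix.mul_inv_rev, Matrix.mul_assoc,
    Matrix.nonsing_inv_mul_cancel_left _ _ hA.isUnit, affineCoord]

theorem contDiff_mul_conjTranspose_const (F₀ : Matrix (Fin d) (Fin N) ℂ) :
    ContDiff ℝ ∞ fun F : Matrix (Fin d) (Fin N) ℂ => F * F₀ᴴ :=
  contDiff_iff_contDiffAt.2 fun _ => contDiffAt_matrix_mul contDiffAt_id contDiffAt_const

theorem contDiffAt_affineCoord (hF : (F * F₀ᴴ).det ≠ 0) : ContDiffAt ℝ ∞ (affineCoord F₀) F :=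
  contDiffAt_matrix_mul
    (contDiffAt_matrix_inv (contDiff_mul_conjTranspose_const F₀).contDiffAt hF) contDiffAt_id

theorem isOpen_setOf_det_mul_conjTranspose_ne_zero (F₀ : Matrix (Fin d) (Fin N) ℂ) :
    IsOpen {F : Matrix (Fin d) (Fin N) ℂ | (F * F₀ᴴ).det ≠ 0} :=
  isOpen_ne.preimage (contDiff_mul_conjTranspose_const F₀).continuous.matrix_det

theorem mul_fderiv_affineCoord_add (hF : (F * F₀ᴴ).det ≠ 0) (T : Matrix (Fin d) (Fin N) ℂ) :
    F * F₀ᴴ * fderiv ℝ (affineCoord F₀) F T + T * F₀ᴴ * affineCoord F₀ F = T := by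
  have hone : (1 : WithTop ℕ∞) ≤ ∞ := by simp
  have hmul : fderiv ℝ (fun F : Matrix (Fin d) (Fin N) ℂ => F * F₀ᴴ) F T = T * F₀ᴴ :=
    DFunLike.congr_fun
      (mulRightLinearMap (Fin d) ℝ F₀ᴴ).toContinuousLinearMap.fderiv T
  have hprod := fderiv_matrix_mul ((contDiff_mul_conjTranspose_const F₀).contDiffAt.of_le hone)
    ((contDiffAt_affineCoord hF).of_le hone) T
  have hself : (fun F => F * F₀ᴴ * affineCoord F₀ F) =ᶠ[nhds F] id := by
    filter_upwards [(isOpen_setOf_det_mul_conjTranspose_ne_zero F₀).mem_nhds hF]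
      with F' hF' using mul_affineCoord hF'
  have hT := DFunLike.congr_fun (hself.fderiv_eq.trans (fderiv_id (𝕜 := ℝ))) T
  exact (congrArg _ (congrArg (· * affineCoord F₀ F) hmul.symm)).trans (hprod.symm.trans hT)

theorem fderiv_affineCoord_mul_conjTranspose (hF : (F * F₀ᴴ).det ≠ 0)
    (T : Matrix (Fin d) (Fin N) ℂ) : fderiv ℝ (affineCoord F₀) F T * F₀ᴴ = 0 := by
  have hT := congrArg (· * F₀ᴴ) (mul_fderiv_affineCoord_add hF T)
  rw [Matrix.add_mul, Matrix.mul_assoc (T * F₀ᴴ), affineCoord_mul_conjTranspose hF, Matrix.mul_one,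
    add_eq_right, Matrix.mul_assoc] at hT
  rw [← Matrix.nonsing_inv_mul_cancel_left _ (_ * F₀ᴴ) hF.isUnit, hT, Matrix.mul_zero]

theorem fderiv_affineCoord_eq_iff (hF : (F * F₀ᴴ).det ≠ 0) {T Y : Matrix (Fin d) (Fin N) ℂ} :
    fderiv ℝ (affineCoord F₀) F T = Y ↔ F * F₀ᴴ * Y + T * F₀ᴴ * affineCoord F₀ F = T := by
  refine ⟨?_, fun h => ?_⟩
  · rintro rfl
    exact mul_fderiv_affineCoord_add hF T
  · rw [← Matrix.nonsing_inv_mul_cancel_left (F * F₀ᴴ) (fderiv _ _ _ _) hF.isUnit,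
      ← Matrix.nonsing_inv_mul_cancel_left (F * F₀ᴴ) Y hF.isUnit,
      add_right_cancel (h.trans (mul_fderiv_affineCoord_add hF T).symm)]

theorem fderiv_affineCoord_eq_zero_iff (hF : (F * F₀ᴴ).det ≠ 0) {T : Matrix (Fin d) (Fin N) ℂ} :
    fderiv ℝ (affineCoord F₀) F T = 0 ↔ ∃ X : Matrix (Fin d) (Fin d) ℂ, T = X * F := by
  rw [fderiv_affineCoord_eq_iff hF, Matrix.mul_zero, zero_add]
  constructor
  · intro hT
    exact ⟨T * F₀ᴴ * (F * F₀ᴴ)⁻¹, by rw [Matrix.mul_assoc, ← affineCoord, hT]⟩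
  · rintro ⟨X, rfl⟩
    rw [Matrix.mul_assoc X, Matrix.mul_assoc, mul_affineCoord hF]

theorem fderiv_affineCoord_of_mul_conjTranspose_eq_zero (hF : (F * F₀ᴴ).det ≠ 0)
    {Y : Matrix (Fin d) (Fin N) ℂ} (hY : Y * F₀ᴴ = 0) :
    fderiv ℝ (affineCoord F₀) F (F * F₀ᴴ * Y) = Y := by
  rw [fderiv_affineCoord_eq_iff hF, Matrix.mul_assoc _ Y, hY, Matrix.mul_zero, Matrix.zero_mul,
    add_zero]

end GrassmannianCoordinates

section Level

variable {d N : ℕ} {c : ℝ} {F F₀ F' : Matrix (Fin d) (Fin N) ℂ}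

theorem exists_unitary_smul_eq (hc : c ≠ 0) (hF : F * Fᴴ = c • (1 : Matrix (Fin d) (Fin d) ℂ))
    (hF' : F' * F'ᴴ = c • (1 : Matrix (Fin d) (Fin d) ℂ)) {X : Matrix (Fin d) (Fin d) ℂ}
    (hX : F = X * F') : ∃ A : U d, A • F' = F := by
  refine ⟨⟨X, Matrix.mem_unitaryGroup_iff.2 (smul_right_injective _ hc ?_)⟩,
    (unitary_smul_eq_mul _ _).trans hX.symm⟩
  rw [hX, Matrix.conjTranspose_mul, Matrix.mul_assoc, ← Matrix.mul_assoc F', hF', Matrix.smul_mul,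
    Matrix.one_mul, Matrix.mul_smul] at hF
  exact hF

theorem exists_unitary_smul_eq_iff_affineCoord_eq (hc : c ≠ 0)
    (hF : F * Fᴴ = c • (1 : Matrix (Fin d) (Fin d) ℂ))
    (hF' : F' * F'ᴴ = c • (1 : Matrix (Fin d) (Fin d) ℂ))
    (h0 : (F * F₀ᴴ).det ≠ 0) :
    (∃ A : U d, A • F' = F) ↔ affineCoord F₀ F = affineCoord F₀ F' := by
  constructor
  · rintro ⟨A, rfl⟩
    exact affineCoord_mul_left (Matrix.UnitaryGroup.det_isUnit A).ne_zero F₀ F'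
  · intro h
    refine exists_unitary_smul_eq hc hF hF' (X := F * F₀ᴴ * (F' * F₀ᴴ)⁻¹) ?_
    rw [Matrix.mul_assoc, ← affineCoord, ← h, mul_affineCoord h0]

theorem exists_unitary_smul_eq_iff_gram_eq (hc : c ≠ 0)
    (hF : F * Fᴴ = c • (1 : Matrix (Fin d) (Fin d) ℂ))
    (hF' : F' * F'ᴴ = c • (1 : Matrix (Fin d) (Fin d) ℂ)) :
    (∃ A : U d, A • F' = F) ↔ Fᴴ * F = F'ᴴ * F' := by
  constructor
  · rintro ⟨A, rfl⟩
    rw [unitary_smul_eq_mul, Matrix.conjTranspose_mul, Matrix.mul_assoc, ← Matrix.mul_assoc _ _ F',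
      unitary_conjTranspose_mul, Matrix.one_mul]
  · intro h
    refine exists_unitary_smul_eq hc hF hF' (X := c⁻¹ • (F * F'ᴴ)) ?_
    rw [Matrix.smul_mul, Matrix.mul_assoc, ← h, ← Matrix.mul_assoc, hF, Matrix.smul_mul,
      Matrix.one_mul, inv_smul_smul₀ hc]

theorem conjTranspose_eq_neg_of_fderiv_momentum_mul_eq_zero (hc : c ≠ 0)
    (hF : F * Fᴴ = c • (1 : Matrix (Fin d) (Fin d) ℂ)) {X : Matrix (Fin d) (Fin d) ℂ}
    (hX : fderiv ℝ (momentum d N) F (X * F) = 0) : Xᴴ = -X := by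
  rw [fderiv_momentum_eq_zero_iff, Matrix.conjTranspose_mul, ← Matrix.mul_assoc, Matrix.mul_assoc X,
    hF, Matrix.smul_mul, Matrix.one_mul, Matrix.mul_smul, Matrix.mul_one, ← smul_add] at hX
  exact eq_neg_of_add_eq_zero_left ((smul_eq_zero_iff_right hc).1 hX)

theorem stdAlt_mul_left_eq_zero {Y : Matrix (Fin d) (Fin N) ℂ} (X : Matrix (Fin d) (Fin d) ℂ)
    (hY : F * Yᴴ = 0) : stdAlt d N ![X * F, Y] = 0 := by
  rw [stdAlt_apply, Matrix.trace_mul_comm, Matrix.mul_assoc, hY, Matrix.mul_zero,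
    Matrix.trace_zero, Complex.zero_im, neg_zero]

/-- A tangent vector splits as `X * F + Z` with `Z * Fᴴ = 0`, and `I • Z`, which is again tangent to
the level set, detects `Z`. -/
theorem stdAlt_eq_zero_on_ker_fderiv_momentum_iff (hc : c ≠ 0)
    (hF : F * Fᴴ = c • (1 : Matrix (Fin d) (Fin d) ℂ)) {T : Matrix (Fin d) (Fin N) ℂ}
    (hT : fderiv ℝ (momentum d N) F T = 0) :
    (∀ T', fderiv ℝ (momentum d N) F T' = 0 → stdAlt d N ![T, T'] = 0) ↔
      ∃ X : Matrix (Fin d) (Fin d) ℂ, T = X * F := by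
  constructor
  · intro hrad
    let X := c⁻¹ • (T * Fᴴ)
    let Z := T - X * F
    have hZF : Z * Fᴴ = 0 := by
      rw [Matrix.sub_mul, Matrix.mul_assoc, hF, Matrix.mul_smul, Matrix.mul_one, smul_inv_smul₀ hc,
        sub_self]
    have hIZF : Complex.I • Z * Fᴴ = 0 := by rw [Matrix.smul_mul, hZF, smul_zero]
    have hFIZ : F * (Complex.I • Z)ᴴ = 0 := by
      simpa using congrArg Matrix.conjTranspose hIZF
    have hIZ : fderiv ℝ (momentum d N) F (Complex.I • Z) = 0 := by
      rw [fderiv_momentum_eq_zero_iff, hFIZ, hIZF, add_zero]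
    refine ⟨X, sub_eq_zero.1 (eq_zero_of_stdAlt_I_smul_right ?_)⟩
    exact ((stdAlt d N).map_vecCons_sub _ _ _).trans <|
      (congrArg₂ (· - ·) (hrad _ hIZ) (stdAlt_mul_left_eq_zero X hFIZ)).trans (sub_zero 0)
  · rintro ⟨X, rfl⟩ T' hT'
    have hX := conjTranspose_eq_neg_of_fderiv_momentum_mul_eq_zero hc hF hT
    rw [stdAlt_lieU_mul ⟨X, hX⟩, hT', map_zero, LinearMap.zero_apply]

end Level

section TightFrameSlices

variable {d N : ℕ} {c : ℝ} {y : Herm d} {F₀ F F' : Matrix (Fin d) (Fin N) ℂ}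

theorem posDef_mul_conjTranspose_of_mem_tightFrames (hc : 0 < c) (hF : F ∈ tightFrames d N c) :
    (F * Fᴴ).PosDef := by
  rw [(mem_tightFrames_iff hc).1 hF]
  exact Matrix.PosDef.one.smul hc

theorem exists_preimage_momentum_eq_tightFrames (hc : 0 < c) :
    ∃ y : Herm d, momentum d N ⁻¹' {y} = tightFrames d N c := by
  refine ⟨-(c • ⟨1, Matrix.conjTranspose_one⟩), ?_⟩
  rw [tightFrames_eq_level hc]
  exact Set.ext fun F => Subtype.ext_iff

theorem exists_projection_affineCoord (hdN : d ≤ N) (hc : c ≠ 0)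
    (hF₀ : F₀ * F₀ᴴ = c • (1 : Matrix (Fin d) (Fin d) ℂ)) :
    ∃ π : Matrix (Fin d) (Fin N) ℂ →L[ℝ] EuclideanSpace ℝ (Fin (2 * (d * N - d ^ 2))),
      (∀ Y : Matrix (Fin d) (Fin N) ℂ, Y * F₀ᴴ = 0 → π Y = 0 → Y = 0) ∧
        ∀ w, ∃ Y : Matrix (Fin d) (Fin N) ℂ, Y * F₀ᴴ = 0 ∧ π Y = w := by
  let R : Matrix (Fin d) (Fin N) ℂ →L[ℝ] Matrix (Fin d) (Fin d) ℂ :=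
    (mulRightLinearMap (Fin d) ℝ F₀ᴴ).toContinuousLinearMap
  have hR : Function.Surjective R := fun X => by
    refine ⟨c⁻¹ • (X * F₀), ?_⟩
    change c⁻¹ • (X * F₀) * F₀ᴴ = X
    rw [Matrix.smul_mul, Matrix.mul_assoc, hF₀, Matrix.mul_smul, Matrix.mul_one, inv_smul_smul₀ hc]
  have hdim : d ^ 2 ≤ d * N := pow_two d ▸ Nat.mul_le_mul_left d hdN
  obtain ⟨π, hinj, hsurj⟩ := exists_bijective_prod (L := R)
    (W := EuclideanSpace ℝ (Fin (2 * (d * N - d ^ 2)))) hR (by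
      rw [finrank_real_matrix, finrank_real_matrix, finrank_euclideanSpace_fin]
      rw [mul_assoc, mul_assoc, ← pow_two, ← mul_add, Nat.add_sub_cancel' hdim])
  refine ⟨π, fun Y hY hπ => hinj ((Prod.ext hY hπ).trans (map_zero (R.prod π)).symm), fun w => ?_⟩
  obtain ⟨Y, hY⟩ := hsurj (0, w)
  exact ⟨Y, congrArg Prod.fst hY, congrArg Prod.snd hY⟩

theorem preservesForm_tightFrames (N : ℕ) (hc : 0 < c) :
    PreservesForm (U d) (stdAlt d N) (tightFrames d N c) where
  contDiff_smul := contDiff_unitary_smul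
  pullback_smul := stdAlt_pullback_unitary_smul
  smul_mem A _ hF := smul_mem_tightFrames hc A hF

theorem t2Space_orbitSpace_tightFrames (N : ℕ) (hc : 0 < c) :
    T2Space (OrbitSpace (U d) (tightFrames d N c)) := by
  have hgram (p p' : tightFrames d N c) : orbitProj (U d) _ p = orbitProj (U d) _ p' ↔
      p.1ᴴ * p.1 = p'.1ᴴ * p'.1 :=
    orbitProj_eq_iff.trans (exists_unitary_smul_eq_iff_gram_eq hc.ne'
      ((mem_tightFrames_iff hc).1 p.2) ((mem_tightFrames_iff hc).1 p'.2))
  have hcont : Continuous fun p : tightFrames d N c => p.1ᴴ * p.1 :=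
    continuous_subtype_val.matrix_conjTranspose.matrix_mul continuous_subtype_val
  refine (t2Space_iff_of_isOpenQuotientMap
    (preservesForm_tightFrames N hc).isOpenQuotientMap_orbitProj).2 ?_
  simp only [hgram]
  exact isClosed_eq (hcont.comp continuous_fst) (hcont.comp continuous_snd)

theorem det_mul_conjTranspose_ne_zero_of_smul {A : U d} (h : (A • F * F₀ᴴ).det ≠ 0) :
    (F * F₀ᴴ).det ≠ 0 := by
  rw [unitary_smul_eq_mul, Matrix.mul_assoc, Matrix.det_mul] at h
  exact right_ne_zero_of_mul h

section Coord

variable {W : Type*} [NormedAddCommGroup W] [NormedSpace ℝ W]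
  {π : Matrix (Fin d) (Fin N) ℂ →L[ℝ] W}

theorem fderiv_comp_affineCoord (hF : (F * F₀ᴴ).det ≠ 0) (T : Matrix (Fin d) (Fin N) ℂ) :
    fderiv ℝ (π ∘ affineCoord F₀) F T = π (fderiv ℝ (affineCoord F₀) F T) :=
  DFunLike.congr_fun (π.hasFDerivAt.comp F
    ((contDiffAt_affineCoord hF).differentiableAt (by simp)).hasFDerivAt).fderiv T

theorem exists_unitary_smul_eq_iff_projection_eq (hc : c ≠ 0)
    (hF : F * Fᴴ = c • (1 : Matrix (Fin d) (Fin d) ℂ))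
    (hF' : F' * F'ᴴ = c • (1 : Matrix (Fin d) (Fin d) ℂ)) (hdet : (F * F₀ᴴ).det ≠ 0)
    (hdet' : (F' * F₀ᴴ).det ≠ 0)
    (hπ : ∀ Y : Matrix (Fin d) (Fin N) ℂ, Y * F₀ᴴ = 0 → π Y = 0 → Y = 0) :
    (∃ A : U d, A • F' = F) ↔ π (affineCoord F₀ F) = π (affineCoord F₀ F') := by
  rw [exists_unitary_smul_eq_iff_affineCoord_eq hc hF hF' hdet, ← sub_eq_zero,
    ← sub_eq_zero (a := π _), ← map_sub]
  refine ⟨fun h => h ▸ map_zero π, hπ _ ?_⟩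
  rw [Matrix.sub_mul, affineCoord_mul_conjTranspose hdet, affineCoord_mul_conjTranspose hdet',
    sub_self]

theorem surjective_fderiv_momentum_prod_affineCoord (hFF : (F * Fᴴ).PosDef)
    (hF : (F * F₀ᴴ).det ≠ 0) (hπ : ∀ w, ∃ Y : Matrix (Fin d) (Fin N) ℂ, Y * F₀ᴴ = 0 ∧ π Y = w) :
    Function.Surjective ((fderiv ℝ (momentum d N) F).prod
      (fderiv ℝ (π ∘ affineCoord F₀) F)) := by
  rintro ⟨K, w⟩
  obtain ⟨Y, hY, rfl⟩ := hπ w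
  set T := F * F₀ᴴ * Y
  obtain ⟨X, hX⟩ := exists_fderiv_momentum_mul_eq hFF (K - fderiv ℝ (momentum d N) F T)
  refine ⟨T + X * F, Prod.ext ?_ ?_⟩
  · exact (map_add _ _ _).trans ((congrArg _ hX).trans (add_sub_cancel _ _))
  · have hXF := (fderiv_affineCoord_eq_zero_iff hF).2 ⟨X, rfl⟩
    have hT := fderiv_affineCoord_of_mul_conjTranspose_eq_zero hF hY
    refine (fderiv_comp_affineCoord hF _).trans (congrArg π ?_)
    exact (map_add _ _ _).trans ((congrArg₂ (· + ·) hT hXF).trans (add_zero Y))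

end Coord

theorem exists_isCharacteristic_localSlice (hdN : d ≤ N) (hc : 0 < c)
    (hy : momentum d N ⁻¹' {y} = tightFrames d N c) (p : momentum d N ⁻¹' {y}) :
    ∃ σ : LocalSlice (orbitProj (U d) (momentum d N ⁻¹' {y}))
      (EuclideanSpace ℝ (Fin (2 * (d * N - d ^ 2)))),
      (p : Matrix (Fin d) (Fin N) ℂ) ∈ σ.dom ∧ σ.IsCharacteristic (stdAlt d N) := by
  have hlevel (p : momentum d N ⁻¹' {y}) : p.1 * p.1ᴴ = c • 1 :=
    (mem_tightFrames_iff hc).1 (hy ▸ p.2)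
  set F₀ := p.1
  obtain ⟨π, hinj, hsurj⟩ := exists_projection_affineCoord hdN hc.ne' (hlevel p)
  have hposDef : (F₀ * F₀ᴴ).PosDef :=
    posDef_mul_conjTranspose_of_mem_tightFrames hc (hy ▸ p.2)
  have hdet : (F₀ * F₀ᴴ).det ≠ 0 := hposDef.det_pos.ne'
  have hsat (p₁ p₂ : momentum d N ⁻¹' {y}) (h : orbitProj (U d) _ p₁ = orbitProj (U d) _ p₂)
      (h₁ : (p₁.1 * F₀ᴴ).det ≠ 0) : (p₂.1 * F₀ᴴ).det ≠ 0 := by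
    obtain ⟨A, hA⟩ := orbitProj_eq_iff.1 h
    exact det_mul_conjTranspose_ne_zero_of_smul (hA ▸ h₁)
  obtain ⟨σ, hp, hdom, hcoord⟩ := LocalSlice.exists_of_surjective_prod (q := orbitProj (U d) _)
    (contDiff_momentum d N) (isOpen_setOf_det_mul_conjTranspose_ne_zero F₀)
    (fun F hF => (π.contDiff.contDiffAt.comp F (contDiffAt_affineCoord hF)).contDiffWithinAt)
    hdet (surjective_fderiv_momentum_prod_affineCoord hposDef hdet hsurj) hsat
    fun p₁ p₂ h₁ h₂ => orbitProj_eq_iff.trans <|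
      exists_unitary_smul_eq_iff_projection_eq hc.ne' (hlevel p₁) (hlevel p₂) h₁ h₂ hinj
  refine ⟨σ, hp, fun p' hp' T hT => ?_⟩
  have hdet' : (p'.1 * F₀ᴴ).det ≠ 0 := hdom hp'
  refine Iff.trans ?_ (stdAlt_eq_zero_on_ker_fderiv_momentum_iff hc.ne' (hlevel p') hT).symm
  rw [← fderiv_affineCoord_eq_zero_iff hdet', hcoord]
  refine (iff_of_eq (congrArg (· = 0) (fderiv_comp_affineCoord hdet' T))).trans ?_
  exact ⟨hinj _ (fderiv_affineCoord_mul_conjTranspose hdet' T), fun h => h ▸ map_zero π⟩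

theorem hasReducedSymplecticForm_tightFrames (hc : 0 < c) (hdN : d ≤ N) :
    HasReducedSymplecticForm (U d) (tightFrames d N c) (stdForm d N) (2 * d * N - d ^ 2)
      (2 * (d * N - d ^ 2)) := by
  have _ : SecondCountableTopology (Matrix (Fin d) (Fin N) ℂ) :=
    inferInstanceAs (SecondCountableTopology (Fin d → Fin N → ℂ))
  obtain ⟨y, hy⟩ := exists_preimage_momentum_eq_tightFrames (d := d) (N := N) hc
  have hdim : Module.finrank ℝ (Matrix (Fin d) (Fin N) ℂ) = Module.finrank ℝ (Herm d) +
      Module.finrank ℝ (EuclideanSpace ℝ (Fin (2 * d * N - d ^ 2))) := by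
    rw [finrank_real_matrix, finrank_herm, finrank_euclideanSpace_fin, Nat.add_sub_cancel']
    nlinarith
  have hG := preservesForm_tightFrames (d := d) N hc
  have hT2 := t2Space_orbitSpace_tightFrames (d := d) N hc
  rw [← hy] at hG hT2 ⊢
  refine hasReducedSymplecticForm_of_localSlices
    ((contDiff_momentum d N).differentiable (by simp)) hG hT2 (fun p => ?_)
    (exists_isCharacteristic_localSlice hdN hc hy)
  exact LocalSlice.exists_of_surjective_fderiv (contDiff_momentum d N) p
    (surjective_fderiv_momentum (posDef_mul_conjTranspose_of_mem_tightFrames hc (hy ▸ p.2))) hdim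

end TightFrameSlices

end FrameReduction

theorem mainTheorem6 (d N : ℕ) (hd : 0 < d) (hdN : d ≤ N) :
    -- the standard form is symplectic, and `α` identifies `H(d)` with `u(d)*`
    IsSymplecticForm (stdForm d N) ∧
    Function.Bijective (alpha d) ∧
    -- the action of `U(d)` is Hamiltonian with momentum map `F ↦ -F F*`
    IsMomentumMap (stdForm d N) (fun F => alpha d (momentum d N F)) ∧
    -- its regular values are exactly the negative definite matrices
    (∀ χ : Herm d, IsRegularValue (momentum d N) χ ↔
      (-(χ : Matrix (Fin d) (Fin d) ℂ)).PosDef) ∧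
    -- the space of `N/d`-tight frames is the level set over `-(N/d) I`
    tightFrames d N ((N : ℝ) / d) =
      {F | (momentum d N F : Matrix (Fin d) (Fin d) ℂ) = -(((N : ℝ) / d) • 1)} ∧
    -- `U(d)` acts on it, freely
    (∀ (A : U d), ∀ F ∈ tightFrames d N ((N : ℝ) / d),
      A • F ∈ tightFrames d N ((N : ℝ) / d)) ∧
    (∀ (A : U d), ∀ F ∈ tightFrames d N ((N : ℝ) / d), A • F = F → A = 1) ∧
    -- the quotient is a smooth manifold with a unique reduced symplectic form
    HasReducedSymplecticForm (U d) (tightFrames d N ((N : ℝ) / d)) (stdForm d N)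
      (2 * d * N - d ^ 2) (2 * (d * N - d ^ 2)) := by
  have hc : 0 < (N : ℝ) / d :=
    div_pos (Nat.cast_pos.2 (hd.trans_le hdN)) (Nat.cast_pos.2 hd)
  exact ⟨isSymplecticForm_stdForm d N, alpha_bijective d, isMomentumMap_momentum d N,
    isRegularValue_momentum_iff hdN, tightFrames_eq_level hc,
    fun A _ hF => smul_mem_tightFrames hc A hF,
    fun A _ hF h => eq_one_of_smul_eq_of_mem_tightFrames hc A hF h,
    hasReducedSymplecticForm_tightFrames hc hdN⟩
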